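/- **Setting.** Let $k_F>0$, $B_F=\{p\in\mathbb Z^3: |p|\le k_F\}$, $B_F^c=\mathbb Z^3\setminus B_F$, $\mathbb Z^3_*=\mathbb Z^3\setminus\{0\}$, and for $k\in\mathbb Z^3_*$ let $$L_k=\{p\in\mathbb Z^3: |p-k|\le k_F<|p|\},\qquad \lambda_{k,p}=\tfrac12\big(|p|^2-|p-k|^2\big).$$ Let $\kappa=\tfrac12\big(\inf_{p\in B_F^c}|p|^2+\sup_{q\in B_F}|q|^2\big)$ and $m(\xi)=\big||\xi|^2-\kappa\big|^{-1}$ for $\xi\in\mathbb Z^3$. Let $\hat V:\mathbb Z^3\to\mathbb R$ satisfy $0\le\hat V_k=\hat V_{-k}$, $\hat V_0=0$ and $\|\hat V\|_{\ell^2}<\infty$. On the real Hilbert space $\ell^2(L_k)$ with orthonormal basis $(e_p)_{p\in L_k}$ let $h_ke_p=\lambda_{k,p}e_p$, $P_k=|v_k\rangle\langle v_k|$ with $v_k=\big(\tfrac{k_F^{-1}\hat V_k}{2(2\pi)^3}\big)^{1/2}\sum_{p\in L_k}e_p$, and $$K_k=-\tfrac12\log\Big[h_k^{-1/2}\big(h_k^{1/2}(h_k+2P_k)h_k^{1/2}\big)^{1/2}h_k^{-1/2}\Big].$$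 For $\xi\in\mathbb Z^3$ let $\mathcal D_{k,\xi}=\{\xi,-\xi,k+\xi,k-\xi\}$ (as a set), and let $$\Theta_{\xi;k}=\tfrac12\sum_{\zeta\in\mathcal D_{k,\xi}\cap L_k}\big(|e_\zeta\rangle\langle e_\zeta|K_k+K_k|e_\zeta\rangle\langle e_\zeta|\big),\qquad \Theta^{2}_{\xi;k}(\tau)=\tfrac12\big(e^{\tau K_k}\Theta_{\xi;k}e^{\tau K_k}-e^{-\tau K_k}\Theta_{\xi;k}e^{-\tau K_k}\big),$$ where the $2$ in $\Theta^2_{\xi;k}$ is an upper index. The bosonization part of the momentum distribution is $$n_{{\rm b},t}(\xi)=\tfrac12\sum_{k\in\mathbb Z^3_*}\int_0^t\operatorname{Tr}\big(\Theta^{2}_{\xi;k}(\tau)\big)\,d\tau .$$ **Proposition.** For every $\xi\in\mathbb Z^3$ and $t\in[0,1]$ the series defining $n_{{\rm b},t}(\xi)$ converges absolutely, and $$n_{{\rm b},t}(\xi)=\tfrac14\sum_{k\in\mathbb Z^3_*}\ \sum_{\zeta\in\mathcal D_{k,\xi}\cap L_k}\big\langle e_\zeta,(\cosh(-2tK_k)-1)e_\zeta\big\rangle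 ,$$ again with absolute convergence. Moreover $$0\le n_{{\rm b},t}(\xi)\le C_V\,k_F^{-1}\,m(\xi),$$ where $C_V>0$ depends only on $\|\hat V\|_{\ell^2}$ (not on $k_F$, $t$ or $\xi$). At $t=1$, $$n_{{\rm b},1}(\xi)=\frac{k_F^{-1}}{32\pi^4}\sum_{k\in\mathbb Z^3_*}\ \sum_{\zeta\in\mathcal D_{k,\xi}\cap L_k}\hat V_k\int_0^\infty\frac{(s^2-\lambda_{k,\zeta}^2)(s^2+\lambda_{k,\zeta}^2)^{-2}}{1+Q_k(s)}\,ds,\qquad Q_k(s)=\frac{k_F^{-1}\hat V_k}{(2\pi)^3}\sum_{p\in L_k}\frac{\lambda_{k,p}}{s^2+\lambda_{k,p}^2},$$ with absolutely convergent integrals and series. -/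

import Mathlib

namespace FermiGas

/-- The momentum lattice `ℤ³`. -/
abbrev Mom : Type := Fin 3 → ℤ

/-- The punctured lattice `ℤ³ \ {0}`. -/
abbrev MomStar : Type := {k : Mom // k ≠ 0}

/-- The squared Euclidean length `|p|²` of a lattice point. -/
def normSq (p : Mom) : ℝ := ∑ i, (p i : ℝ) ^ 2

/-- The Fermi ball `B_F = {p ∈ ℤ³ : |p| ≤ k_F}`. -/
def fermiBall (kF : ℝ) : Set Mom := {p | Real.sqrt (normSq p) ≤ kF}

/-- The lune `L_k = {p ∈ ℤ³ : |p - k| ≤ k_F < |p|}`. -/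
def lune (kF : ℝ) (k : Mom) : Set Mom := {p | p - k ∈ fermiBall kF ∧ p ∉ fermiBall kF}

theorem fermiBall_finite (kF : ℝ) : (fermiBall kF).Finite := by
  refine (Set.finite_Icc (fun _ : Fin 3 => ⌊-kF⌋) (fun _ => ⌈kF⌉)).subset ?_
  intro p hp
  have key : ∀ i, |(p i : ℝ)| ≤ kF := by
    intro i
    refine le_trans ?_ hp
    rw [← Real.sqrt_sq_eq_abs]
    apply Real.sqrt_le_sqrt
    exact Finset.single_le_sum (f := fun j => ((p j : ℤ) : ℝ) ^ 2)
      (fun j _ => sq_nonneg _) (Finset.mem_univ i)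
  constructor
  · intro i
    have h : ((⌊-kF⌋ : ℤ) : ℝ) ≤ (p i : ℝ) := (Int.floor_le _).trans (abs_le.1 (key i)).1
    exact_mod_cast h
  · intro i
    have h : (p i : ℝ) ≤ ((⌈kF⌉ : ℤ) : ℝ) := (abs_le.1 (key i)).2.trans (Int.le_ceil _)
    exact_mod_cast h

theorem lune_finite (kF : ℝ) (k : Mom) : (lune kF k).Finite := by
  refine ((fermiBall_finite kF).image (fun q => q + k)).subset ?_
  intro p hp
  exact ⟨p - k, hp.1, sub_add_cancel p k⟩

noncomputable instance luneFintype (kF : ℝ) (k : Mom) : Fintype (lune kF k) :=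
  (lune_finite kF k).fintype

/-- `κ = (inf_{p ∉ B_F} |p|² + sup_{q ∈ B_F} |q|²) / 2`. -/
noncomputable def kappa (kF : ℝ) : ℝ :=
  (1 / 2) * (sInf (normSq '' (fermiBall kF)ᶜ) + sSup (normSq '' fermiBall kF))

/-- The weight `m(p)`, given by `m(p)⁻¹ = ||p|² - κ|`. -/
noncomputable def gapWeight (kF : ℝ) (p : Mom) : ℝ := |normSq p - kappa kF|⁻¹

/-- `λ_{k,p} = (|p|² - |p - k|²) / 2`. -/
noncomputable def lam (k p : Mom) : ℝ := (1 / 2) * (normSq p - normSq (p - k))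

/-- The norm `‖V̂‖_{ℓ²}`; it is used for square summable families only. -/
noncomputable def ell2Norm (V : Mom → ℝ) : ℝ := Real.sqrt (∑' k, V k ^ 2)

/-- The operators on the real Hilbert space `ℓ²(L_k)`, written as matrices with respect to the
orthonormal basis `(e_p)`, `p ∈ L_k`. A function `f` of a symmetric operator `A` is `cfc f A`. -/
abbrev Op (kF : ℝ) (k : Mom) : Type := Matrix (lune kF k) (lune kF k) ℝ

/-- The basis vector `e_ζ` of `ℓ²(L_k)`, where `ζ ∈ L_k`. -/
def basisVec (kF : ℝ) (k ζ : Mom) : lune kF k → ℝ := fun p => if (p : Mom) = ζ then 1 else 0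

/-- The matrix element `⟨e_ζ, A e_ζ⟩`. -/
noncomputable def diagElt {kF : ℝ} {k : Mom} (A : Op kF k) (ζ : Mom) : ℝ :=
  basisVec kF k ζ ⬝ᵥ A.mulVec (basisVec kF k ζ)

/-- The rank-one projection `P_{ζ;k} = |e_ζ⟩⟨e_ζ|`. -/
noncomputable def basisProj (kF : ℝ) (k ζ : Mom) : Op kF k :=
  Matrix.vecMulVec (basisVec kF k ζ) (basisVec kF k ζ)

/-- The operator `h_k`, with `h_k e_p = λ_{k,p} e_p`. -/
noncomputable def hOp (kF : ℝ) (k : Mom) : Op kF k := Matrix.diagonal fun p => lam k p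

/-- The vector `v_k = (k_F⁻¹ V̂_k / (2 (2π)³))^{1/2} ∑_{p ∈ L_k} e_p`. -/
noncomputable def vVec (kF : ℝ) (V : Mom → ℝ) (k : Mom) : lune kF k → ℝ :=
  fun _ => Real.sqrt (kF⁻¹ * V k / (2 * (2 * Real.pi) ^ 3))

/-- The operator `P_k = |v_k⟩⟨v_k|`. -/
noncomputable def pOp (kF : ℝ) (V : Mom → ℝ) (k : Mom) : Op kF k :=
  Matrix.vecMulVec (vVec kF V k) (vVec kF V k)

/-- `h_k^{1/2}`. -/
noncomputable def hSqrt (kF : ℝ) (k : Mom) : Op kF k := cfc Real.sqrt (hOp kF k)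

/-- `h_k^{-1/2}`. -/
noncomputable def hInvSqrt (kF : ℝ) (k : Mom) : Op kF k :=
  cfc (fun x : ℝ => (Real.sqrt x)⁻¹) (hOp kF k)

/-- The Bogoliubov kernel
`K_k = -(1/2) log [h_k^{-1/2} (h_k^{1/2} (h_k + 2 P_k) h_k^{1/2})^{1/2} h_k^{-1/2}]`. -/
noncomputable def kOp (kF : ℝ) (V : Mom → ℝ) (k : Mom) : Op kF k :=
  (-(1 / 2) : ℝ) • cfc Real.log
    (hInvSqrt kF k *
      cfc Real.sqrt (hSqrt kF k * (hOp kF k + (2 : ℝ) • pOp kF V k) * hSqrt kF k) *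
      hInvSqrt kF k)

/-- The set `𝒟_{k,ξ} = {±ξ, k ± ξ}`. -/
def dSet (k ξ : Mom) : Finset Mom := {ξ, -ξ, k + ξ, k - ξ}

open Classical in
/-- The set `𝒟_{k,ξ} ∩ L_k`. -/
noncomputable def dLune (kF : ℝ) (k ξ : Mom) : Finset Mom :=
  (dSet k ξ).filter fun ζ => ζ ∈ lune kF k

/-- `Θ_{ξ;k} = (1/2) ∑_{ζ ∈ 𝒟_{k,ξ}} χ_{L_k}(ζ) {P_{ζ;k}, K_k}`. -/
noncomputable def thetaOp (kF : ℝ) (V : Mom → ℝ) (k ξ : Mom) : Op kF k :=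
  (1 / 2 : ℝ) • ∑ ζ ∈ dLune kF k ξ,
    (basisProj kF k ζ * kOp kF V k + kOp kF V k * basisProj kF k ζ)

/-- The transform `T²_k(τ) = (1/2) (e^{τ K_k} T_k e^{τ K_k} - e^{-τ K_k} T_k e^{-τ K_k})`
of an operator `T_k` on `ℓ²(L_k)`. The `2` is an upper index, not a square. -/
noncomputable def transformTwo (kF : ℝ) (V : Mom → ℝ) (k : Mom) (T : Op kF k) (τ : ℝ) :
    Op kF k :=
  (1 / 2 : ℝ) •
    (cfc Real.exp (τ • kOp kF V k) * T * cfc Real.exp (τ • kOp kF V k) -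
      cfc Real.exp ((-τ) • kOp kF V k) * T * cfc Real.exp ((-τ) • kOp kF V k))

/-- `∫₀ᵗ Tr Θ²_{ξ;k}(τ) dτ`. -/
noncomputable def traceIntegral (kF : ℝ) (V : Mom → ℝ) (t : ℝ) (ξ k : Mom) : ℝ :=
  ∫ τ in (0 : ℝ)..t, (transformTwo kF V k (thetaOp kF V k ξ) τ).trace

/-- The bosonization part
`n_{b,t}(ξ) = (1/2) ∑_{k ≠ 0} ∫₀ᵗ Tr Θ²_{ξ;k}(τ) dτ` of the momentum distribution. -/
noncomputable def nBoson (kF : ℝ) (V : Mom → ℝ) (t : ℝ) (ξ : Mom) : ℝ :=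
  (1 / 2) * ∑' k : MomStar, traceIntegral kF V t ξ k

/-- `⟨e_ζ, (cosh(-2t K_k) - 1) e_ζ⟩`. -/
noncomputable def coshElt (kF : ℝ) (V : Mom → ℝ) (t : ℝ) (k ζ : Mom) : ℝ :=
  diagElt (cfc Real.cosh ((-2 * t) • kOp kF V k) - 1) ζ

/-- `Q_k(s) = k_F⁻¹ V̂_k / (2π)³ ∑_{p ∈ L_k} λ_{k,p} / (s² + λ_{k,p}²)`. -/
noncomputable def qFun (kF : ℝ) (V : Mom → ℝ) (k : Mom) (s : ℝ) : ℝ :=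
  kF⁻¹ * V k / (2 * Real.pi) ^ 3 * ∑ p : lune kF k, lam k p / (s ^ 2 + lam k p ^ 2)

/-- The integrand `(s² - λ²) (s² + λ²)⁻² / (1 + Q_k(s))` with `λ = λ_{k,ζ}`. -/
noncomputable def bosonIntegrand (kF : ℝ) (V : Mom → ℝ) (k ζ : Mom) (s : ℝ) : ℝ :=
  (s ^ 2 - lam k ζ ^ 2) * ((s ^ 2 + lam k ζ ^ 2) ^ 2)⁻¹ / (1 + qFun kF V k s)

end FermiGas

/-! Write `E = e^{-2K} = h^{-1/2} X^{1/2} h^{-1/2}` with `X = h² + 2|u⟩⟨u|` and `u = h^{1/2} v`.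
Every operator built from `K` is a function of `E`, so cyclicity of the trace turns `Tr Θ²(τ)` into
a sum of diagonal elements of `K sinh(2τK)`. Integration over `τ` gives half the diagonal elements
of `cosh(2tK) - 1` (`traceIntegral_eq`). Diagonal elements are averages over the spectrum, so these
are nonnegative and increase with `t`; only `t = 1` needs an estimate.

At `t = 1`, `cosh(2K) = (E + E⁻¹)/2` involves only the diagonal elements of `X^{1/2}` and
`X^{-1/2}`. These are integrals over `s` of the resolvent of `X` at `-s²`, which is explicit because
`X` is a rank-one perturbation of a diagonal matrix (`resolvent_diag`). This yields the integral
formula `coshElt_one_eq_integral`.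

For the bound, the integrand without the factor `1/(1+Q)` has integral zero, so the element is of
second order in the coupling: at most `2g² (∑ λ⁻¹) λ_ζ⁻¹` (`coshElt_one_le_sq`). Three facts finish
the case `k_F ≥ 1`: `g ≤ V_k/k_F`; `λ_ζ⁻¹ ≤ 2 m(ξ)`, as `κ` separates the two energies whose
difference is `2λ_ζ` (`inv_lam_le_gapWeight`); and `∑ λ⁻¹ ≤ 1488 k_F`, by counting lattice points of
the lune in dyadic slabs (`sum_inv_lam_le`). The sum over `k` is then controlled by `‖V‖²`.

For `k_F < 1` the lune is the single point `k`, and the first-order bound `g/λ` is used instead.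
Then only `k = ±ξ` contribute, unless `ξ = 0`, where `λ_{k,k} = |k|²/2` and `V_k |k|⁻²` is dominated
by `V_k² + |k|⁻⁴`. -/

namespace FermiGas

/-! ### Functional calculus of real symmetric matrices. -/

section Calculus

variable {n : Type*} [Fintype n] [DecidableEq n]

theorem continuousOn_spectrum (M : Matrix n n ℝ) (f : ℝ → ℝ) : ContinuousOn f (spectrum ℝ M) :=
  M.finite_real_spectrum.continuousOn f

/-- The spectrum is finite, so `f` agrees on it with a Lagrange interpolation polynomial, and
polynomials commute with the algebra homomorphism `Matrix.diagonal`. -/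
theorem cfc_diagonal (d : n → ℝ) (f : ℝ → ℝ) :
    cfc f (Matrix.diagonal d) = Matrix.diagonal (fun i => f (d i)) := by
  have hsa : IsSelfAdjoint (Matrix.diagonal d) := by
    rw [isSelfAdjoint_iff, Matrix.star_eq_conjTranspose, Matrix.diagonal_conjTranspose, star_trivial]
  have hfin := (Matrix.diagonal d).finite_real_spectrum
  set q := Lagrange.interpolate hfin.toFinset id f with hq
  have hqf : ∀ x ∈ spectrum ℝ (Matrix.diagonal d), f x = q.eval x := fun x hx => by
    have := Lagrange.eval_interpolate_at_node (s := hfin.toFinset) (v := id) f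
      (Function.injective_id.injOn) (hfin.mem_toFinset.2 hx)
    exact this.symm
  rw [cfc_congr (g := q.eval) hqf, cfc_polynomial q _ hsa]
  have h := Polynomial.aeval_algHom_apply (Matrix.diagonalAlgHom (n := n) (α := ℝ) ℝ) d q
  change Polynomial.aeval (Matrix.diagonal d) q = Matrix.diagonal _ at h
  rw [h]
  congr 1
  ext i
  have hd : d i ∈ spectrum ℝ (Matrix.diagonal d) := by
    rw [_root_.spectrum_diagonal]
    exact ⟨i, rfl⟩
  rw [hqf _ hd, Polynomial.aeval_fn_apply, Polynomial.coe_aeval_eq_eval]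

/-- Diagonal entries of functions of a symmetric matrix are averages over its spectrum. -/
theorem exists_spectral_weights {M : Matrix n n ℝ} (hM : M.IsHermitian) (a : n) :
    ∃ w : n → ℝ, (∀ i, 0 ≤ w i) ∧ ∑ i, w i = 1 ∧
      ∀ f : ℝ → ℝ, cfc f M a a = ∑ i, w i * f (hM.eigenvalues i) := by
  have key : ∀ f : ℝ → ℝ, cfc f M a a =
      ∑ i, ((hM.eigenvectorUnitary : Matrix n n ℝ) a i) ^ 2 * f (hM.eigenvalues i) := by
    intro f
    rw [hM.cfc_eq, Matrix.IsHermitian.cfc, Unitary.conjStarAlgAut_apply, Matrix.mul_apply]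
    refine Finset.sum_congr rfl fun i _ => ?_
    rw [Matrix.mul_diagonal, Matrix.star_apply]
    simp only [Function.comp_apply, star_trivial, RCLike.ofReal_real_eq_id, id_eq]
    ring
  refine ⟨_, fun i => sq_nonneg _, ?_, key⟩
  have h1 := key (fun _ => 1)
  rw [cfc_const_one ℝ M hM.isSelfAdjoint] at h1
  simpa using h1.symm

theorem posDef_cfc {M : Matrix n n ℝ} (hM : M.IsHermitian) {f : ℝ → ℝ}
    (hf : ∀ i, 0 < f (hM.eigenvalues i)) : (cfc f M).PosDef := by
  rw [hM.cfc_eq, Matrix.IsHermitian.cfc, Unitary.conjStarAlgAut_apply]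
  have hD : (Matrix.diagonal (RCLike.ofReal ∘ f ∘ hM.eigenvalues : n → ℝ)).PosDef :=
    Matrix.PosDef.diagonal fun i => by simpa using hf i
  have hU : IsUnit (star (hM.eigenvectorUnitary : Matrix n n ℝ)) :=
    (Unitary.toUnits (star hM.eigenvectorUnitary)).isUnit
  have := hD.conjTranspose_mul_mul_same (B := star (hM.eigenvectorUnitary : Matrix n n ℝ))
    (Matrix.mulVec_injective_of_isUnit hU)
  simpa [Matrix.star_eq_conjTranspose] using this

/-- Functions of the generator `-(1/2) log M`. -/
theorem cfc_smul_log {M : Matrix n n ℝ} (hM : M.IsHermitian) (F : ℝ → ℝ) (τ : ℝ) :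
    cfc F (τ • ((-(1 / 2) : ℝ) • cfc Real.log M)) =
      cfc (fun x => F (τ * (-(1 / 2) * Real.log x))) M := by
  rw [smul_smul, ← cfc_const_mul (τ * -(1 / 2)) Real.log M (continuousOn_spectrum _ _),
    ← cfc_comp' F _ M ((M.finite_real_spectrum.image _).continuousOn _)
      (continuousOn_spectrum _ _) hM.isSelfAdjoint]
  simp only [mul_assoc]

/-- By cyclicity both outer factors `g(M)` meet on one side of the anticommutator; they commute with
`f(M)`, so its two terms contribute equally. -/
theorem trace_conj_anticommutator {M : Matrix n n ℝ} (a : n) (f g : ℝ → ℝ) :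
    (cfc g M * (Matrix.single a a 1 * cfc f M + cfc f M * Matrix.single a a 1) *
      cfc g M).trace = 2 * cfc (fun x => f x * (g x * g x)) M a a := by
  have hc := continuousOn_spectrum M
  have hgg : cfc g M * cfc g M = cfc (fun x => g x * g x) M := (cfc_mul g g M (hc _) (hc _)).symm
  have e1 : cfc f M * (cfc g M * cfc g M) = cfc (fun x => f x * (g x * g x)) M := by
    rw [hgg, cfc_mul f (fun x => g x * g x) M (hc _) (hc _)]
  have e2 : cfc g M * cfc g M * cfc f M = cfc (fun x => f x * (g x * g x)) M := by
    rw [hgg, ← cfc_mul (fun x => g x * g x) f M (hc _) (hc _)]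
    simp only [mul_comm]
  rw [Matrix.trace_mul_comm, ← mul_assoc, mul_add, Matrix.trace_add, ← mul_assoc, ← mul_assoc,
    Matrix.trace_mul_single]
  rw [mul_assoc _ _ (cfc f M), Matrix.trace_mul_comm (cfc g M * cfc g M), mul_assoc, e1, e2,
    Matrix.trace_single_mul]
  simp [two_mul]

end Calculus

/-! ### From the trace of `Θ²` to diagonal elements of `cosh`. -/

section Trace

variable {kF : ℝ} {V : Mom → ℝ} {k : Mom}

theorem basisVec_eq (ζ : lune kF k) : basisVec kF k ζ = Pi.single ζ 1 := by
  ext p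
  simp [basisVec, Pi.single_apply, Subtype.ext_iff]

theorem diagElt_eq (A : Op kF k) (ζ : lune kF k) : diagElt A ζ = A ζ ζ := by
  simp [diagElt, basisVec_eq]

theorem basisProj_eq (ζ : lune kF k) : basisProj kF k ζ = Matrix.single ζ ζ 1 := by
  rw [basisProj, basisVec_eq, ← Matrix.single_eq_single_vecMulVec_single]

theorem mem_lune_of_mem_dLune {ξ ζ : Mom} (h : ζ ∈ dLune kF k ξ) : ζ ∈ lune kF k := by
  classical
  simp only [dLune, Finset.mem_filter] at h
  exact h.2

/-- The operator `h_k^{-1/2} (h_k^{1/2} (h_k + 2 P_k) h_k^{1/2})^{1/2} h_k^{-1/2} = e^{-2 K_k}`. -/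
noncomputable def eOp (kF : ℝ) (V : Mom → ℝ) (k : Mom) : Op kF k :=
  hInvSqrt kF k *
      cfc Real.sqrt (hSqrt kF k * (hOp kF k + (2 : ℝ) • pOp kF V k) * hSqrt kF k) *
      hInvSqrt kF k

theorem kOp_eq : kOp kF V k = (-(1 / 2) : ℝ) • cfc Real.log (eOp kF V k) := rfl

/-- The eigenvalue of `K_k` as a function of the eigenvalue of `e^{-2 K_k}`. -/
noncomputable def kVal (x : ℝ) : ℝ := -(1 / 2) * Real.log x

theorem trace_transformTwo (hE : (eOp kF V k).IsHermitian) (ξ : Mom) (τ : ℝ) :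
    (transformTwo kF V k (thetaOp kF V k ξ) τ).trace =
      ∑ ζ ∈ dLune kF k ξ,
        diagElt (cfc (fun x => kVal x * Real.sinh (2 * τ * kVal x)) (eOp kF V k)) ζ := by
  have hk1 : kOp kF V k = cfc kVal (eOp kF V k) := by
    have := cfc_smul_log hE id 1
    simp only [one_smul, one_mul, id_eq] at this
    change _ = cfc (fun x => -(1 / 2) * Real.log x) (eOp kF V k)
    rw [kOp_eq, ← this, cfc_id ℝ _ ?_]
    rw [isSelfAdjoint_iff, star_smul, (cfc_predicate Real.log (eOp kF V k)).star_eq, star_trivial]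
  have hexp : ∀ τ : ℝ, cfc Real.exp (τ • kOp kF V k) =
      cfc (fun x => Real.exp (τ * kVal x)) (eOp kF V k) := fun τ => by
    rw [kOp_eq, cfc_smul_log hE]; rfl
  have key : ∀ τ : ℝ, (cfc Real.exp (τ • kOp kF V k) * thetaOp kF V k ξ *
      cfc Real.exp (τ • kOp kF V k)).trace = ∑ ζ ∈ dLune kF k ξ,
        diagElt (cfc (fun x => kVal x * Real.exp (2 * τ * kVal x)) (eOp kF V k)) ζ := by
    intro τ
    rw [hexp, thetaOp, Matrix.mul_smul, Matrix.smul_mul, Matrix.trace_smul, Finset.mul_sum,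
      Finset.sum_mul, Matrix.trace_sum, Finset.smul_sum]
    refine Finset.sum_congr rfl fun ζ hζ => ?_
    lift ζ to lune kF k using mem_lune_of_mem_dLune hζ
    rw [basisProj_eq, hk1, trace_conj_anticommutator, diagElt_eq]
    simp only [smul_eq_mul, ← Real.exp_add]
    rw [← mul_assoc]
    norm_num
    refine congrArg (fun f : ℝ → ℝ => cfc f (eOp kF V k) ζ ζ) (funext fun x => ?_)
    ring_nf
  rw [transformTwo, Matrix.trace_smul, Matrix.trace_sub, key, key, ← Finset.sum_sub_distrib,
    Finset.smul_sum]
  refine Finset.sum_congr rfl fun ζ hζ => ?_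
  lift ζ to lune kF k using mem_lune_of_mem_dLune hζ
  obtain ⟨w, -, -, hw⟩ := exists_spectral_weights hE ζ
  simp only [diagElt_eq, hw, ← Finset.sum_sub_distrib, smul_eq_mul, Finset.mul_sum]
  refine Finset.sum_congr rfl fun i _ => ?_
  rw [Real.sinh_eq]
  ring_nf

theorem coshElt_eq (hE : (eOp kF V k).IsHermitian) (t : ℝ) (ζ : lune kF k) :
    coshElt kF V t k ζ =
      cfc (fun x => Real.cosh (2 * t * kVal x)) (eOp kF V k) ζ ζ - 1 := by
  rw [coshElt, diagElt_eq, Matrix.sub_apply, Matrix.one_apply_eq, kOp_eq, cfc_smul_log hE]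
  refine congrArg (fun f : ℝ → ℝ => cfc f (eOp kF V k) ζ ζ - 1) (funext fun x => ?_)
  rw [← Real.cosh_neg, kVal]
  ring_nf

theorem integral_mul_sinh (c t : ℝ) :
    ∫ τ in (0 : ℝ)..t, c * Real.sinh (2 * τ * c) = (1 / 2) * (Real.cosh (2 * t * c) - 1) := by
  have hd : ∀ τ : ℝ, HasDerivAt (fun τ => (1 / 2) * Real.cosh (2 * τ * c))
      (c * Real.sinh (2 * τ * c)) τ := fun τ => by
    have h1 : HasDerivAt (fun τ : ℝ => 2 * τ * c) (2 * c) τ := by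
      simpa using ((hasDerivAt_id τ).const_mul 2).mul_const c
    exact (h1.cosh.const_mul (1 / 2)).congr_deriv (by ring)
  rw [intervalIntegral.integral_eq_sub_of_hasDerivAt (fun τ _ => hd τ)
    (Continuous.intervalIntegrable (by fun_prop) _ _)]
  simp
  ring

theorem traceIntegral_eq (hE : (eOp kF V k).IsHermitian) (t : ℝ) (ξ : Mom) :
    traceIntegral kF V t ξ k = (1 / 2) * ∑ ζ ∈ dLune kF k ξ, coshElt kF V t k ζ := by
  have hint : ∀ ζ : lune kF k,
      IntervalIntegrable (fun τ : ℝ => diagElt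
        (cfc (fun x => kVal x * Real.sinh (2 * τ * kVal x)) (eOp kF V k)) ζ)
        MeasureTheory.volume 0 t ∧
      ∫ τ in (0 : ℝ)..t, diagElt
        (cfc (fun x => kVal x * Real.sinh (2 * τ * kVal x)) (eOp kF V k)) ζ =
        (1 / 2) * coshElt kF V t k ζ := by
    intro ζ
    obtain ⟨w, -, hw1, hw⟩ := exists_spectral_weights hE ζ
    rw [coshElt_eq hE]
    simp only [diagElt_eq, hw]
    constructor
    · exact Continuous.intervalIntegrable (by fun_prop) _ _
    · rw [intervalIntegral.integral_finsetSum
        (fun i _ => Continuous.intervalIntegrable (by fun_prop) _ _)]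
      simp_rw [intervalIntegral.integral_const_mul (w _), integral_mul_sinh]
      trans (1 / 2) * (∑ i, w i * Real.cosh (2 * t * kVal (hE.eigenvalues i)) - ∑ i, w i)
      · rw [← Finset.sum_sub_distrib, Finset.mul_sum]
        exact Finset.sum_congr rfl fun i _ => by ring
      · rw [hw1]
  simp only [traceIntegral, trace_transformTwo hE]
  rw [intervalIntegral.integral_finsetSum, Finset.mul_sum]
  · refine Finset.sum_congr rfl fun ζ hζ => ?_
    exact (hint ⟨ζ, mem_lune_of_mem_dLune hζ⟩).2
  · exact fun ζ hζ => (hint ⟨ζ, mem_lune_of_mem_dLune hζ⟩).1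

theorem coshElt_nonneg (hE : (eOp kF V k).IsHermitian) (t : ℝ) (ζ : lune kF k) :
    0 ≤ coshElt kF V t k ζ := by
  obtain ⟨w, hw0, hw1, hw⟩ := exists_spectral_weights hE ζ
  rw [coshElt_eq hE, hw, ← hw1, ← Finset.sum_sub_distrib]
  exact Finset.sum_nonneg fun i _ => by nlinarith [hw0 i, Real.one_le_cosh (2 * t * kVal (hE.eigenvalues i))]

/-- The spectral weights are nonnegative and `cosh` increases with the absolute value of its
argument. This reduces the upper bound to `t = 1`. -/
theorem coshElt_le_one (hE : (eOp kF V k).IsHermitian) {t : ℝ} (ht : t ∈ Set.Icc (0 : ℝ) 1)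
    (ζ : lune kF k) : coshElt kF V t k ζ ≤ coshElt kF V 1 k ζ := by
  obtain ⟨w, hw0, hw1, hw⟩ := exists_spectral_weights hE ζ
  rw [coshElt_eq hE, coshElt_eq hE, hw, hw]
  gcongr with i _
  · exact hw0 i
  rw [Real.cosh_le_cosh, mul_one, abs_mul, abs_mul, abs_mul, abs_of_nonneg ht.1]
  have := abs_nonneg (kVal (hE.eigenvalues i))
  have h2 : |(2 : ℝ)| = 2 := abs_two
  nlinarith [ht.2, mul_le_mul_of_nonneg_right ht.2 this]

end Trace

/-! ### Resolvent of a rank-one perturbation of a diagonal matrix. -/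

section RankOne

variable {n : Type*} [Fintype n] [DecidableEq n]

/-- The matrix `h² + 2 |u⟩⟨u|` with `h = diag l` and `u = √g · √l`. -/
noncomputable def rankOnePert (l : n → ℝ) (g : ℝ) : Matrix n n ℝ :=
  Matrix.diagonal (fun p => l p ^ 2) +
    (2 * g) • Matrix.vecMulVec (fun p => Real.sqrt (l p)) (fun p => Real.sqrt (l p))

variable {l : n → ℝ} {g : ℝ}

theorem posDef_rankOnePert (hl : ∀ p, 0 < l p) (hg : 0 ≤ g) : (rankOnePert l g).PosDef := by
  refine Matrix.PosDef.add_posSemidef (Matrix.PosDef.diagonal fun p => pow_pos (hl p) 2) ?_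
  refine Matrix.PosSemidef.smul ?_ (by positivity)
  simpa using Matrix.posSemidef_vecMulVec_self_star (fun p => Real.sqrt (l p))

/-- This is the Sherman–Morrison formula. Column `a` of the resolvent is guessed as `y`, checked to
solve `(s² + X) y = e_a`, and then read off at `a`. Positivity of `l` makes `s = 0` admissible. -/
theorem resolvent_diag (hl : ∀ p, 0 < l p) (hg : 0 ≤ g) (s : ℝ) (a : n) :
    cfc (fun x => (s ^ 2 + x)⁻¹) (rankOnePert l g) a a =
      (s ^ 2 + l a ^ 2)⁻¹ - 2 * g * l a /
        ((s ^ 2 + l a ^ 2) ^ 2 * (1 + 2 * g * ∑ p, l p / (s ^ 2 + l p ^ 2))) := by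
  have hX := posDef_rankOnePert hl hg
  set X := rankOnePert l g with hXdef
  have hpos : ∀ p, 0 < s ^ 2 + l p ^ 2 := fun p => by have := hl p; positivity
  set Q := 2 * g * ∑ p, l p / (s ^ 2 + l p ^ 2) with hQ
  have hQ0 : 0 ≤ Q := mul_nonneg (by positivity)
    (Finset.sum_nonneg fun p _ => div_nonneg (hl p).le (hpos p).le)
  set R := cfc (fun x => (s ^ 2 + x)⁻¹) X
  have hRX : R * cfc (fun x => s ^ 2 + x) X = 1 := by
    rw [← cfc_mul _ _ X (continuousOn_spectrum _ _) (continuousOn_spectrum _ _),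
      ← cfc_const_one ℝ X hX.isHermitian.isSelfAdjoint]
    refine cfc_congr fun x hx => ?_
    rw [hX.isHermitian.spectrum_real_eq_range_eigenvalues] at hx
    obtain ⟨i, rfl⟩ := hx
    have := hX.eigenvalues_pos i
    exact inv_mul_cancel₀ (by positivity)
  rw [cfc_const_add _ _ _ (continuousOn_spectrum _ _) hX.isHermitian.isSelfAdjoint,
    cfc_id' ℝ X hX.isHermitian.isSelfAdjoint] at hRX
  -- The self-consistent value of `2g ⟨√l, y⟩`: pairing the ansatz `y` with `√l` gives `c (1 + Q) =
  -- 2g √(l a) / (s² + (l a)²)`.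
  set c := 2 * g * Real.sqrt (l a) / ((s ^ 2 + l a ^ 2) * (1 + Q)) with hc
  set y : n → ℝ := fun p => (if p = a then (s ^ 2 + l a ^ 2)⁻¹ else 0) -
    c * Real.sqrt (l p) / (s ^ 2 + l p ^ 2) with hy
  have hsum : 2 * g * ∑ q, Real.sqrt (l q) * y q = c := by
    have e1 : ∀ q, Real.sqrt (l q) * y q =
        (if q = a then Real.sqrt (l a) * (s ^ 2 + l a ^ 2)⁻¹ else 0) -
          c * (l q / (s ^ 2 + l q ^ 2)) := fun q => by
      have hs := Real.mul_self_sqrt (hl q).le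
      simp only [hy]
      split_ifs with h
      · subst h
        rw [mul_sub, ← mul_div_assoc, ← mul_div_assoc]
        congr 2
        linear_combination c * hs
      · rw [mul_sub, ← mul_div_assoc, ← mul_div_assoc]
        congr 2
        · simp
        · linear_combination c * hs
    simp only [e1, Finset.sum_sub_distrib, ← Finset.mul_sum, Finset.sum_ite_eq', Finset.mem_univ,
      if_true]
    have e2 : 2 * g * (Real.sqrt (l a) * (s ^ 2 + l a ^ 2)⁻¹) = c * (1 + Q) := by
      rw [hc]
      have := (hpos a).ne'
      have : (1 + Q) ≠ 0 := by positivity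
      field_simp
    rw [mul_sub, e2]
    linear_combination -c * hQ
  have hDy : (algebraMap ℝ (Matrix n n ℝ) (s ^ 2) + X).mulVec y = Pi.single a 1 := by
    ext p
    have e3 : ((algebraMap ℝ (Matrix n n ℝ) (s ^ 2) + X).mulVec y) p =
        (s ^ 2 + l p ^ 2) * y p + Real.sqrt (l p) * (2 * g * ∑ q, Real.sqrt (l q) * y q) := by
      rw [hXdef, rankOnePert, Matrix.algebraMap_eq_diagonal, Matrix.add_mulVec, Matrix.add_mulVec,
        Matrix.smul_mulVec, Matrix.vecMulVec_mulVec]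
      simp only [Pi.add_apply, Matrix.mulVec_diagonal, Pi.smul_apply, dotProduct, smul_eq_mul,
        MulOpposite.smul_eq_mul_unop, MulOpposite.unop_op]
      simp only [Pi.algebraMap_apply, Algebra.algebraMap_self, RingHom.id_apply]
      ring
    rw [e3, hsum]
    simp only [hy, Pi.single_apply]
    have := (hpos p).ne'
    split_ifs with h
    · subst h
      field_simp
      ring
    · field_simp
      ring
  have hRy : R.mulVec (Pi.single a 1) = y := by
    rw [← hDy, Matrix.mulVec_mulVec, hRX, Matrix.one_mulVec]
  have := congrFun hRy a
  rw [Matrix.mulVec_single_one, Matrix.col_apply] at this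
  rw [this]
  simp only [hy, if_true, hc]
  congr 1
  have hs := Real.mul_self_sqrt (hl a).le
  have h1 := (hpos a).ne'
  have h2 : (1 + Q) ≠ 0 := by positivity
  field_simp
  linear_combination g * hs

end RankOne

/-! ### The operators on the lune and the spectral form of `cosh(2K) - 1`. -/

section Lune

variable {kF : ℝ} {V : Mom → ℝ} {k : Mom}

theorem normSq_eq_intCast (p : Mom) : normSq p = ((∑ i, p i ^ 2 : ℤ) : ℝ) := by
  simp [normSq]

theorem normSq_nonneg (p : Mom) : 0 ≤ normSq p := Finset.sum_nonneg fun _ _ => sq_nonneg _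

theorem mem_fermiBall (hkF : 0 ≤ kF) (p : Mom) : p ∈ fermiBall kF ↔ normSq p ≤ kF ^ 2 :=
  Real.sqrt_le_left hkF

/-- `2λ` is a difference of two integers, and it is positive because `k_F` separates `|p - k|` from
`|p|`. -/
theorem half_le_lam (hkF : 0 ≤ kF) (p : lune kF k) : 1 / 2 ≤ lam k p := by
  have h1 := (mem_fermiBall hkF _).1 p.2.1
  have h2 := mt (mem_fermiBall hkF _).2 p.2.2
  have h3 : normSq (p - k) < normSq p := by linarith
  rw [normSq_eq_intCast, normSq_eq_intCast] at h3
  have h4 : ((∑ i, ((p : Mom) - k) i ^ 2 : ℤ) : ℝ) + 1 ≤ ((∑ i, (p : Mom) i ^ 2 : ℤ) : ℝ) := by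
    exact_mod_cast h3
  rw [← normSq_eq_intCast, ← normSq_eq_intCast] at h4
  rw [lam]
  linarith

theorem lam_pos (hkF : 0 ≤ kF) (p : lune kF k) : 0 < lam k p :=
  lt_of_lt_of_le (by norm_num) (half_le_lam hkF p)

/-- The coupling constant `k_F⁻¹ V̂_k / (2 (2π)³)`. -/
noncomputable def coupling (kF : ℝ) (V : Mom → ℝ) (k : Mom) : ℝ :=
  kF⁻¹ * V k / (2 * (2 * Real.pi) ^ 3)

theorem coupling_nonneg (hkF : 0 < kF) (hV : 0 ≤ V k) : 0 ≤ coupling kF V k := by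
  unfold coupling; positivity

/-- The matrix `h_k^{1/2} (h_k + 2 P_k) h_k^{1/2}`. -/
noncomputable abbrev xOp (kF : ℝ) (V : Mom → ℝ) (k : Mom) : Op kF k :=
  rankOnePert (fun p : lune kF k => lam k p) (coupling kF V k)

theorem posDef_xOp (hkF : 0 < kF) (hV : 0 ≤ V k) : (xOp kF V k).PosDef :=
  posDef_rankOnePert (lam_pos hkF.le) (coupling_nonneg hkF hV)

theorem hSqrt_conj_eq (hkF : 0 < kF) (hV : 0 ≤ V k) :
    hSqrt kF k * (hOp kF k + (2 : ℝ) • pOp kF V k) * hSqrt kF k = xOp kF V k := by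
  rw [hSqrt, hOp, cfc_diagonal]
  ext p q
  rw [Matrix.mul_diagonal, Matrix.diagonal_mul, xOp, rankOnePert]
  simp only [Matrix.add_apply, Matrix.smul_apply, pOp, Matrix.vecMulVec_apply, vVec, smul_eq_mul,
    Matrix.diagonal_apply]
  have hg := Real.mul_self_sqrt (coupling_nonneg hkF hV)
  unfold coupling at hg
  rw [hg]
  split_ifs with h
  · subst h
    have := Real.mul_self_sqrt (lam_pos hkF.le p).le
    rw [coupling]
    linear_combination (lam k p) * this
  · rw [coupling]
    ring

theorem eOp_eq (hkF : 0 < kF) (hV : 0 ≤ V k) :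
    eOp kF V k = Matrix.diagonal (fun p : lune kF k => (Real.sqrt (lam k p))⁻¹) *
      cfc Real.sqrt (xOp kF V k) * Matrix.diagonal (fun p : lune kF k => (Real.sqrt (lam k p))⁻¹) := by
  rw [eOp, hSqrt_conj_eq hkF hV, hInvSqrt, hOp, cfc_diagonal]

theorem posDef_eOp (hkF : 0 < kF) (hV : 0 ≤ V k) : (eOp kF V k).PosDef := by
  have hX := posDef_xOp hkF hV
  have hS : (cfc Real.sqrt (xOp kF V k)).PosDef :=
    posDef_cfc hX.isHermitian fun i => Real.sqrt_pos.2 (hX.eigenvalues_pos i)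
  have hD : IsUnit (Matrix.diagonal (fun p : lune kF k => (Real.sqrt (lam k p))⁻¹)) := by
    rw [Matrix.isUnit_diagonal, Pi.isUnit_iff]
    exact fun p => (inv_ne_zero (Real.sqrt_pos.2 (lam_pos hkF.le p)).ne').isUnit
  have := hS.conjTranspose_mul_mul_same (Matrix.mulVec_injective_of_isUnit hD)
  rw [eOp_eq hkF hV]
  simpa using this

/-- Inverting the three factors gives `E⁻¹ = h^{1/2} X^{-1/2} h^{1/2}`; both sides are inverses of
`E`. -/
theorem cfc_inv_eOp (hkF : 0 < kF) (hV : 0 ≤ V k) :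
    cfc (fun x : ℝ => x⁻¹) (eOp kF V k) =
      Matrix.diagonal (fun p : lune kF k => Real.sqrt (lam k p)) *
        cfc (fun x => (Real.sqrt x)⁻¹) (xOp kF V k) *
        Matrix.diagonal (fun p : lune kF k => Real.sqrt (lam k p)) := by
  have hX := posDef_xOp hkF hV
  have hE := posDef_eOp hkF hV
  have h1 : cfc (fun x : ℝ => x⁻¹) (eOp kF V k) * eOp kF V k = 1 := by
    nth_rewrite 2 [← cfc_id' ℝ (eOp kF V k) hE.isHermitian.isSelfAdjoint]
    rw [← cfc_mul _ _ _ (continuousOn_spectrum _ _) (continuousOn_spectrum _ _),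
      ← cfc_const_one ℝ (eOp kF V k) hE.isHermitian.isSelfAdjoint]
    refine cfc_congr fun x hx => ?_
    rw [hE.isHermitian.spectrum_real_eq_range_eigenvalues] at hx
    obtain ⟨i, rfl⟩ := hx
    exact inv_mul_cancel₀ (hE.eigenvalues_pos i).ne'
  have hSS : cfc Real.sqrt (xOp kF V k) * cfc (fun x => (Real.sqrt x)⁻¹) (xOp kF V k) = 1 := by
    rw [← cfc_mul _ _ _ (continuousOn_spectrum _ _) (continuousOn_spectrum _ _),
      ← cfc_const_one ℝ (xOp kF V k) hX.isHermitian.isSelfAdjoint]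
    refine cfc_congr fun x hx => ?_
    rw [hX.isHermitian.spectrum_real_eq_range_eigenvalues] at hx
    obtain ⟨i, rfl⟩ := hx
    exact mul_inv_cancel₀ (Real.sqrt_pos.2 (hX.eigenvalues_pos i)).ne'
  have hne : ∀ p : lune kF k, Real.sqrt (lam k p) ≠ 0 := fun p =>
    (Real.sqrt_pos.2 (lam_pos hkF.le p)).ne'
  have hDD : Matrix.diagonal (fun p : lune kF k => (Real.sqrt (lam k p))⁻¹) *
      Matrix.diagonal (fun p : lune kF k => Real.sqrt (lam k p)) = 1 := by
    rw [Matrix.diagonal_mul_diagonal, ← Matrix.diagonal_one]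
    congr 1
    ext p
    exact inv_mul_cancel₀ (hne p)
  have h2 : eOp kF V k * (Matrix.diagonal (fun p : lune kF k => Real.sqrt (lam k p)) *
        cfc (fun x => (Real.sqrt x)⁻¹) (xOp kF V k) *
        Matrix.diagonal (fun p : lune kF k => Real.sqrt (lam k p))) = 1 := by
    rw [eOp_eq hkF hV]
    simp only [mul_assoc]
    rw [← mul_assoc (Matrix.diagonal _) (Matrix.diagonal _), hDD, one_mul,
      ← mul_assoc (cfc _ _) (cfc _ _), hSS, one_mul, hDD]
  exact left_inv_eq_right_inv h1 h2

/-- Spectral form of `⟨e_ζ, (cosh(2 K_k) - 1) e_ζ⟩` and of the resolvent of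
`h_k^{1/2} (h_k + 2 P_k) h_k^{1/2}`. -/
theorem exists_coshElt_weights (hkF : 0 < kF) (hV : 0 ≤ V k) (ζ : lune kF k) :
    ∃ w y : lune kF k → ℝ, (∀ i, 0 < y i) ∧ ∑ i, w i = 1 ∧
      coshElt kF V 1 k ζ = ∑ i, w i * (y i / (2 * lam k ζ) + lam k ζ / (2 * y i) - 1) ∧
      ∀ s, ∑ i, w i * (s ^ 2 + y i ^ 2)⁻¹ =
        (s ^ 2 + lam k ζ ^ 2)⁻¹ - 2 * coupling kF V k * lam k ζ /
          ((s ^ 2 + lam k ζ ^ 2) ^ 2 *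
            (1 + 2 * coupling kF V k * ∑ p : lune kF k, lam k p / (s ^ 2 + lam k p ^ 2))) := by
  have hX := posDef_xOp hkF hV
  have hE := posDef_eOp hkF hV
  obtain ⟨w, hw0, hw1, hw⟩ := exists_spectral_weights hX.isHermitian ζ
  refine ⟨w, fun i => Real.sqrt (hX.isHermitian.eigenvalues i),
    fun i => Real.sqrt_pos.2 (hX.eigenvalues_pos i), hw1, ?_, fun s => ?_⟩
  · have hcosh : cfc (fun x => Real.cosh (2 * 1 * kVal x)) (eOp kF V k) =
        (1 / 2 : ℝ) • eOp kF V k + (1 / 2 : ℝ) • cfc (fun x : ℝ => x⁻¹) (eOp kF V k) := by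
      have hc := continuousOn_spectrum (eOp kF V k)
      nth_rewrite 2 [← cfc_id' ℝ (eOp kF V k) hE.isHermitian.isSelfAdjoint]
      rw [← cfc_const_mul _ _ _ (hc _), ← cfc_const_mul _ _ _ (hc _), ← cfc_add _ _ _ (hc _) (hc _)]
      refine cfc_congr fun x hx => ?_
      rw [hE.isHermitian.spectrum_real_eq_range_eigenvalues] at hx
      obtain ⟨i, rfl⟩ := hx
      have := Real.cosh_log (hE.eigenvalues_pos i)
      rw [← Real.cosh_neg, kVal, show -(2 * 1 * (-(1 / 2) * Real.log (hE.isHermitian.eigenvalues i)))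
        = Real.log (hE.isHermitian.eigenvalues i) by ring, this]
      ring
    rw [coshElt_eq hE.isHermitian, hcosh, Matrix.add_apply, Matrix.smul_apply, Matrix.smul_apply,
      cfc_inv_eOp hkF hV, eOp_eq hkF hV]
    -- Conjugation by a diagonal matrix only rescales a diagonal entry, here by `λ⁻¹` for `E` and by
    -- `λ` for `E⁻¹`. Hence the spectral weights of `X` serve both terms, and the resolvent as well.
    simp only [Matrix.mul_diagonal, Matrix.diagonal_mul, hw, smul_eq_mul]
    have hl := lam_pos hkF.le ζ
    have hs := Real.mul_self_sqrt hl.le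
    have hs' : (Real.sqrt (lam k ζ))⁻¹ * (Real.sqrt (lam k ζ))⁻¹ = (lam k ζ)⁻¹ := by
      rw [← mul_inv, hs]
    simp only [mul_sub, Finset.sum_sub_distrib, mul_one, hw1, mul_add, Finset.sum_add_distrib]
    congr 2
    · rw [mul_right_comm, hs', ← mul_assoc, Finset.mul_sum]
      refine Finset.sum_congr rfl fun i _ => ?_
      ring
    · rw [mul_right_comm, hs, ← mul_assoc, Finset.mul_sum]
      refine Finset.sum_congr rfl fun i _ => ?_
      ring
  · rw [← resolvent_diag (l := fun p : lune kF k => lam k p) (lam_pos hkF.le)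
      (coupling_nonneg hkF hV), hw]
    refine Finset.sum_congr rfl fun i _ => ?_
    rw [Real.sq_sqrt (hX.eigenvalues_pos i).le]

end Lune

open MeasureTheory Set

/-! ### Elementary integrals over the half-line. -/

section Integrals

theorem integrableOn_inv_sq_add_sq {c : ℝ} (hc : 0 < c) :
    IntegrableOn (fun s : ℝ => (s ^ 2 + c ^ 2)⁻¹) (Ioi 0) := by
  have h := (integrable_inv_one_add_sq.comp_mul_left' (inv_ne_zero hc.ne')).const_mul (c ^ 2)⁻¹
  refine (h.congr (Filter.Eventually.of_forall fun s => ?_)).integrableOn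
  simp only
  rw [← mul_inv]
  congr 1
  field_simp
  ring

theorem integral_inv_sq_add_sq {c : ℝ} (hc : 0 < c) :
    ∫ s in Ioi (0 : ℝ), (s ^ 2 + c ^ 2)⁻¹ = Real.pi / (2 * c) := by
  have h := integral_comp_mul_left_Ioi (fun s : ℝ => (1 + s ^ 2)⁻¹) 0 (inv_pos.2 hc)
  rw [mul_zero, integral_Ioi_inv_one_add_sq, inv_inv] at h
  have e : ∀ s : ℝ, (s ^ 2 + c ^ 2)⁻¹ = (c ^ 2)⁻¹ * (1 + (c⁻¹ * s) ^ 2)⁻¹ := fun s => by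
    rw [← mul_inv]
    congr 1
    field_simp
    ring
  simp only [e]
  rw [integral_const_mul, h]
  simp only [Real.arctan_zero, sub_zero, smul_eq_mul]
  field_simp

/-- The antiderivative `-s / (s² + c²)` vanishes at `0` and at infinity. This cancellation removes
the first-order term in the coupling. -/
theorem integral_sub_div_sq {c : ℝ} (hc : 0 < c) :
    IntegrableOn (fun s : ℝ => (s ^ 2 - c ^ 2) * ((s ^ 2 + c ^ 2) ^ 2)⁻¹) (Ioi 0) ∧
    ∫ s in Ioi (0 : ℝ), (s ^ 2 - c ^ 2) * ((s ^ 2 + c ^ 2) ^ 2)⁻¹ = 0 := by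
  have hpos : ∀ s : ℝ, 0 < s ^ 2 + c ^ 2 := fun s => by positivity
  have hint : IntegrableOn (fun s : ℝ => (s ^ 2 - c ^ 2) * ((s ^ 2 + c ^ 2) ^ 2)⁻¹) (Ioi 0) := by
    refine (integrableOn_inv_sq_add_sq hc).mono' ?_ (Filter.Eventually.of_forall fun s => ?_)
    · refine Continuous.aestronglyMeasurable (Continuous.mul (by fun_prop)
        (Continuous.inv₀ (by fun_prop) fun s => (pow_pos (hpos s) 2).ne'))
    · rw [norm_mul, norm_inv, Real.norm_eq_abs, Real.norm_of_nonneg (by positivity),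
        ← div_eq_mul_inv, div_le_iff₀ (pow_pos (hpos s) 2), pow_two (s ^ 2 + c ^ 2), ← mul_assoc,
        inv_mul_cancel₀ (hpos s).ne', one_mul, abs_le]
      constructor <;> nlinarith [sq_nonneg s, sq_nonneg c]
  refine ⟨hint, ?_⟩
  have hd : ∀ s ∈ Ici (0 : ℝ), HasDerivAt (fun s : ℝ => -s / (s ^ 2 + c ^ 2))
      ((s ^ 2 - c ^ 2) * ((s ^ 2 + c ^ 2) ^ 2)⁻¹) s := fun s _ => by
    have h1 : HasDerivAt (fun s : ℝ => s ^ 2 + c ^ 2) (2 * s) s := by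
      simpa using (hasDerivAt_pow 2 s).add_const (c ^ 2)
    refine ((hasDerivAt_id s).neg.div h1 (hpos s).ne').congr_deriv ?_
    rw [div_eq_mul_inv]
    simp only [Pi.neg_apply, id_eq]
    ring
  have hlim : Filter.Tendsto (fun s : ℝ => -s / (s ^ 2 + c ^ 2)) Filter.atTop (nhds 0) := by
    refine squeeze_zero_norm' ?_ tendsto_inv_atTop_zero
    filter_upwards [Filter.eventually_gt_atTop 0] with s hs
    rw [norm_div, norm_neg, Real.norm_of_nonneg hs.le, Real.norm_of_nonneg (hpos s).le,
      div_le_iff₀ (hpos s), inv_mul_eq_div, le_div_iff₀ hs]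
    nlinarith [sq_nonneg c]
  rw [integral_Ioi_of_hasDerivAt_of_tendsto' hd hint hlim]
  simp

end Integrals

/-! ### The integral formula at `t = 1` and bounds of first and second order in the coupling. -/

section Lune

variable {kF : ℝ} {V : Mom → ℝ} {k : Mom}

theorem qFun_eq (s : ℝ) : qFun kF V k s =
    2 * coupling kF V k * ∑ p : lune kF k, lam k p / (s ^ 2 + lam k p ^ 2) := by
  rw [qFun, coupling]
  congr 1
  field_simp

theorem qFun_nonneg (hkF : 0 < kF) (hV : 0 ≤ V k) (s : ℝ) : 0 ≤ qFun kF V k s := by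
  rw [qFun_eq]
  refine mul_nonneg (mul_nonneg (by norm_num) (coupling_nonneg hkF hV))
    (Finset.sum_nonneg fun p _ => div_nonneg (lam_pos hkF.le p).le (by positivity))

theorem qFun_le (hkF : 0 < kF) (hV : 0 ≤ V k) (s : ℝ) :
    qFun kF V k s ≤ 2 * coupling kF V k * ∑ p : lune kF k, (lam k p)⁻¹ := by
  rw [qFun_eq]
  refine mul_le_mul_of_nonneg_left (Finset.sum_le_sum fun p _ => ?_)
    (mul_nonneg (by norm_num) (coupling_nonneg hkF hV))
  have := lam_pos hkF.le p
  rw [div_le_iff₀ (by positivity), inv_mul_eq_div, le_div_iff₀ this]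
  nlinarith [sq_nonneg s]

theorem continuous_bosonIntegrand (hkF : 0 < kF) (hV : 0 ≤ V k) (ζ : lune kF k) :
    Continuous (bosonIntegrand kF V k ζ) := by
  have hpos : ∀ (p : lune kF k) (s : ℝ), 0 < s ^ 2 + lam k p ^ 2 := fun p s => by
    have := lam_pos hkF.le p
    positivity
  have hq : Continuous (qFun kF V k) := by
    refine Continuous.mul continuous_const (continuous_finsetSum _ fun p _ => ?_)
    exact Continuous.div (by fun_prop) (by fun_prop) fun s => (hpos p s).ne'
  refine Continuous.div (Continuous.mul (by fun_prop)
    (Continuous.inv₀ (by fun_prop) fun s => (pow_pos (hpos ζ s) 2).ne')) (by fun_prop) fun s => ?_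
  have := qFun_nonneg hkF hV s
  positivity

theorem abs_bosonIntegrand_le (hkF : 0 < kF) (hV : 0 ≤ V k) (ζ : lune kF k) (s : ℝ) :
    |bosonIntegrand kF V k ζ s| ≤ (s ^ 2 + lam k ζ ^ 2)⁻¹ := by
  have hl := lam_pos hkF.le ζ
  have hpos : 0 < s ^ 2 + lam k ζ ^ 2 := by positivity
  have hQ := qFun_nonneg hkF hV s
  have h1 : |s ^ 2 - lam k ζ ^ 2| ≤ s ^ 2 + lam k ζ ^ 2 := by
    rw [abs_le]
    constructor <;> nlinarith [sq_nonneg s, sq_nonneg (lam k ζ)]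
  rw [bosonIntegrand, abs_div, abs_mul, abs_inv, abs_of_pos (pow_pos hpos 2),
    abs_of_pos (by linarith : 0 < 1 + qFun kF V k s)]
  refine (div_le_self (by positivity) (by linarith)).trans ?_
  rw [← div_eq_mul_inv, div_le_iff₀ (pow_pos hpos 2), pow_two (s ^ 2 + lam k ζ ^ 2), ← mul_assoc,
    inv_mul_cancel₀ hpos.ne', one_mul]
  exact h1

theorem integrableOn_bosonIntegrand (hkF : 0 < kF) (hV : 0 ≤ V k) (ζ : lune kF k) :
    IntegrableOn (bosonIntegrand kF V k ζ) (Ioi 0) :=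
  (integrableOn_inv_sq_add_sq (lam_pos hkF.le ζ)).mono'
    (continuous_bosonIntegrand hkF hV ζ).aestronglyMeasurable
    (Filter.Eventually.of_forall (abs_bosonIntegrand_le hkF hV ζ))

/-- Each spectral value `y` enters as `y/(2l) + l/(2y) - 1`, which is `1/(πl)` times the integral of
`(y² + l²)/(s² + y²) - 2l²/(s² + l²)`. Averaging this integrand over the weights inserts the
resolvent formula. -/
theorem coshElt_one_eq_integral (hkF : 0 < kF) (hV : 0 ≤ V k) (ζ : lune kF k) :
    coshElt kF V 1 k ζ =
      2 * coupling kF V k / Real.pi * ∫ s in Ioi (0 : ℝ), bosonIntegrand kF V k ζ s := by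
  obtain ⟨w, y, hy, hw1, hcosh, hres⟩ := exists_coshElt_weights hkF hV ζ
  have hl := lam_pos hkF.le ζ
  set l := lam k ζ
  have hpt : ∀ s : ℝ, 2 * coupling kF V k * l * bosonIntegrand kF V k ζ s =
      ∑ i, w i * ((y i ^ 2 + l ^ 2) * (s ^ 2 + y i ^ 2)⁻¹ - 2 * l ^ 2 * (s ^ 2 + l ^ 2)⁻¹) := by
    intro s
    have hpos : s ^ 2 + l ^ 2 ≠ 0 := by positivity
    have h1Q : 1 + qFun kF V k s ≠ 0 := by
      have := qFun_nonneg hkF hV s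
      positivity
    have hres' := hres s
    rw [← qFun_eq] at hres'
    -- The integrand depends on `y i` only through the resolvent term. As the weights sum to one,
    -- the first term cancels against the unperturbed resolvent, leaving the rank-one correction.
    have e : ∀ i, w i * ((y i ^ 2 + l ^ 2) * (s ^ 2 + y i ^ 2)⁻¹ - 2 * l ^ 2 * (s ^ 2 + l ^ 2)⁻¹) =
        (s ^ 2 - l ^ 2) * (s ^ 2 + l ^ 2)⁻¹ * w i -
          (s ^ 2 - l ^ 2) * (w i * (s ^ 2 + y i ^ 2)⁻¹) := fun i => by
      have := hy i
      have h2 : s ^ 2 + y i ^ 2 ≠ 0 := by positivity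
      field_simp
      ring
    simp only [e]
    rw [Finset.sum_sub_distrib, ← Finset.mul_sum, ← Finset.mul_sum, hw1, hres', bosonIntegrand]
    change 2 * coupling kF V k * l *
      ((s ^ 2 - l ^ 2) * ((s ^ 2 + l ^ 2) ^ 2)⁻¹ / (1 + qFun kF V k s)) = _
    field_simp
    ring
  have hint : 2 * coupling kF V k * l * ∫ s in Ioi (0 : ℝ), bosonIntegrand kF V k ζ s =
      Real.pi * l * coshElt kF V 1 k ζ := by
    rw [← integral_const_mul]
    simp only [hpt]
    rw [integral_finsetSum]
    · rw [hcosh, Finset.mul_sum]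
      refine Finset.sum_congr rfl fun i _ => ?_
      rw [integral_const_mul, integral_sub, integral_const_mul, integral_const_mul,
        integral_inv_sq_add_sq (hy i), integral_inv_sq_add_sq hl]
      · have := (hy i).ne'
        change _ = Real.pi * l * (w i * (y i / (2 * l) + l / (2 * y i) - 1))
        field_simp
      · exact (integrableOn_inv_sq_add_sq (hy i)).const_mul _
      · exact (integrableOn_inv_sq_add_sq hl).const_mul _
    · intro i _
      exact (((integrableOn_inv_sq_add_sq (hy i)).const_mul _).sub
        ((integrableOn_inv_sq_add_sq hl).const_mul _)).const_mul _
  have hpi := Real.pi_pos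
  rw [div_mul_eq_mul_div, eq_div_iff hpi.ne']
  have := mul_left_cancel₀ hl.ne' (a := l)
    (b := coshElt kF V 1 k ζ * Real.pi)
    (c := 2 * coupling kF V k * ∫ s in Ioi (0 : ℝ), bosonIntegrand kF V k ζ s)
  exact this (by linear_combination -hint)

theorem coshElt_one_le (hkF : 0 < kF) (hV : 0 ≤ V k) (ζ : lune kF k) :
    coshElt kF V 1 k ζ ≤ coupling kF V k * (lam k ζ)⁻¹ := by
  have hl := lam_pos hkF.le ζ
  have hg := coupling_nonneg hkF hV
  have hpi := Real.pi_pos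
  have h1 : ∫ s in Ioi (0 : ℝ), bosonIntegrand kF V k ζ s ≤ Real.pi / (2 * lam k ζ) := by
    rw [← integral_inv_sq_add_sq hl]
    exact integral_mono (integrableOn_bosonIntegrand hkF hV ζ) (integrableOn_inv_sq_add_sq hl)
      fun s => (le_abs_self _).trans (abs_bosonIntegrand_le hkF hV ζ s)
  rw [coshElt_one_eq_integral hkF hV]
  refine (mul_le_mul_of_nonneg_left h1 (by positivity)).trans_eq ?_
  field_simp

/-- With `f` the integrand, `f = f (1 + Q) - f Q`. The first term integrates to zero, and the second
is at most `Q (s² + λ²)⁻¹` with `Q` bounded by its value at `s = 0`. -/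
theorem coshElt_one_le_sq (hkF : 0 < kF) (hV : 0 ≤ V k) (ζ : lune kF k) :
    coshElt kF V 1 k ζ ≤
      2 * coupling kF V k ^ 2 * (∑ p : lune kF k, (lam k p)⁻¹) * (lam k ζ)⁻¹ := by
  have hl := lam_pos hkF.le ζ
  have hg := coupling_nonneg hkF hV
  have hpi := Real.pi_pos
  set S := ∑ p : lune kF k, (lam k p)⁻¹ with hS
  have hb : ∀ s, bosonIntegrand kF V k ζ s ≤
      (s ^ 2 - lam k ζ ^ 2) * ((s ^ 2 + lam k ζ ^ 2) ^ 2)⁻¹ +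
        2 * coupling kF V k * S * (s ^ 2 + lam k ζ ^ 2)⁻¹ := by
    intro s
    have hpos : 0 < s ^ 2 + lam k ζ ^ 2 := by positivity
    have hQ := qFun_nonneg hkF hV s
    have hQS := qFun_le hkF hV s
    rw [← hS] at hQS
    have h1 : (s ^ 2 - lam k ζ ^ 2) * ((s ^ 2 + lam k ζ ^ 2) ^ 2)⁻¹ =
        bosonIntegrand kF V k ζ s * (1 + qFun kF V k s) := by
      rw [bosonIntegrand, div_mul_cancel₀]
      positivity
    have h2 := (neg_le_abs _).trans (abs_bosonIntegrand_le hkF hV ζ s)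
    rw [h1]
    have h3 := mul_le_mul_of_nonneg_left h2 hQ
    have h4 := mul_le_mul_of_nonneg_right hQS (inv_pos.2 hpos).le
    linarith
  have h1 : ∫ s in Ioi (0 : ℝ), bosonIntegrand kF V k ζ s ≤
      2 * coupling kF V k * S * (Real.pi / (2 * lam k ζ)) := by
    obtain ⟨hi, h0⟩ := integral_sub_div_sq hl
    have hi' := (integrableOn_inv_sq_add_sq hl).const_mul (2 * coupling kF V k * S)
    have := integral_mono (integrableOn_bosonIntegrand hkF hV ζ) (hi.add hi') hb
    rwa [integral_add' hi hi', h0, zero_add, integral_const_mul, integral_inv_sq_add_sq hl] at this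
  rw [coshElt_one_eq_integral hkF hV]
  refine (mul_le_mul_of_nonneg_left h1 (by positivity)).trans_eq ?_
  field_simp

end Lune

/-! ### Counting lattice points by comparison of volumes. -/

section Counting

/-- Cylindrical coordinates around an axis `u` preserve the volume. -/
theorem exists_cylindrical_coordinates {u : EuclideanSpace ℝ (Fin 3)} (hu : ‖u‖ = 1) :
    ∃ Φ : EuclideanSpace ℝ (Fin 3) →ₗ[ℝ] ℝ × EuclideanSpace ℝ (Fin 2), MeasurePreserving Φ ∧
      (∀ x, (Φ x).1 = inner ℝ u x) ∧ ∀ x, ‖x‖ ^ 2 = (Φ x).1 ^ 2 + ‖(Φ x).2‖ ^ 2 := by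
  have hv : Orthonormal ℝ (({0} : Set (Fin 3)).domRestrict fun _ => u) := by
    refine ⟨fun i => hu, fun i j hij => absurd (Subsingleton.elim i j) hij⟩
  obtain ⟨b, hb⟩ := hv.exists_orthonormalBasis_extension_of_card_eq (by simp)
  have hb0 : b 0 = u := hb 0 rfl
  refine ⟨{ toFun := fun x => (b.repr x 0, WithLp.toLp 2 fun j : Fin 2 => b.repr x j.succ)
            map_add' := ?_
            map_smul' := ?_ }, ?_, ?_, ?_⟩
  · intro x y
    ext <;> simp
  · intro c x
    ext <;> simp
  · have h1 := b.measurePreserving_repr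
    have h2 := PiLp.volume_preserving_ofLp (Fin 3)
    have h3 := volume_preserving_piFinSuccAbove (fun _ : Fin 3 => ℝ) 0
    have h4 := (MeasurePreserving.id (volume : Measure ℝ)).prod
      (PiLp.volume_preserving_toLp (Fin 2))
    exact h4.comp (h3.comp (h2.comp h1))
  · intro x
    simp [b.repr_apply_apply, hb0]
  · intro x
    rw [← b.repr.norm_map x, EuclideanSpace.norm_sq_eq, EuclideanSpace.norm_sq_eq,
      Fin.sum_univ_succ]
    simp

/-- The lattice point `p` as a vector of Euclidean space. -/
noncomputable def toEuclid (p : Mom) : EuclideanSpace ℝ (Fin 3) :=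
  WithLp.toLp 2 fun i => (p i : ℝ)

theorem norm_toEuclid_sq (p : Mom) : ‖toEuclid p‖ ^ 2 = normSq p := by
  rw [EuclideanSpace.norm_sq_eq]
  simp [toEuclid, normSq]

theorem toEuclid_sub (p q : Mom) : toEuclid p - toEuclid q = toEuclid (p - q) := by
  ext i
  simp [toEuclid]

theorem one_le_normSq {p : Mom} (hp : p ≠ 0) : 1 ≤ normSq p := by
  rw [normSq_eq_intCast]
  have h : 0 < ∑ i, p i ^ 2 := by
    obtain ⟨i, hi⟩ := Function.ne_iff.1 hp
    exact Finset.sum_pos' (fun j _ => sq_nonneg _) ⟨i, Finset.mem_univ i, by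
      have : p i ≠ 0 := hi
      positivity⟩
  exact_mod_cast h

theorem pairwiseDisjoint_ball (S : Set Mom) :
    S.PairwiseDisjoint fun p => Metric.ball (toEuclid p) (1 / 2) := by
  intro p _ q _ hpq
  refine Metric.ball_disjoint_ball ?_
  have h := one_le_normSq (sub_ne_zero.2 hpq)
  rw [← norm_toEuclid_sq, ← toEuclid_sub, ← dist_eq_norm] at h
  nlinarith [dist_nonneg (x := toEuclid p) (y := toEuclid q)]

/-- The number of lattice points in a cylindrical shell. -/
theorem card_le_of_cylinder {u : EuclideanSpace ℝ (Fin 3)} (hu : ‖u‖ = 1) {S : Finset Mom}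
    {α β A B R : ℝ} (hαβ : α ≤ β) (hA : 0 ≤ A) (hAB : A ≤ B) (hR : 1 ≤ R) (hB : B ≤ R ^ 2)
    (hS : ∀ p ∈ S, inner ℝ u (toEuclid p) ∈ Icc α β ∧
      A ≤ normSq p - inner ℝ u (toEuclid p) ^ 2 ∧
      normSq p - inner ℝ u (toEuclid p) ^ 2 ≤ B) :
    (S.card : ℝ) ≤ 6 * (β - α + 1) * (B - A + 2 * R) := by
  obtain ⟨Φ, hΦ, hΦ1, hΦ2⟩ := exists_cylindrical_coordinates hu
  -- The disjoint balls of radius `1/2` around the points of `S` lie in the shell widened by `1/2`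
  -- on every side.
  set r := max (Real.sqrt A - 1 / 2) 0 with hr
  have hr0 : 0 ≤ r := le_max_right _ _
  set ρ := Real.sqrt B + 1 / 2 with hρ
  have hρ0 : 0 ≤ ρ := by positivity
  have hsAB : Real.sqrt A ≤ Real.sqrt B := Real.sqrt_le_sqrt hAB
  have hrρ : r ≤ ρ := max_le (by linarith) hρ0
  set T : Set (ℝ × EuclideanSpace ℝ (Fin 2)) :=
    Icc (α - 1 / 2) (β + 1 / 2) ×ˢ (Metric.ball 0 ρ \ Metric.ball 0 r) with hT
  have hTm : MeasurableSet T :=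
    measurableSet_Icc.prod (measurableSet_ball.diff measurableSet_ball)
  have hTvol : volume (Φ ⁻¹' T) =
      ENNReal.ofReal ((β - α + 1) * (Real.pi * (ρ ^ 2 - r ^ 2))) := by
    rw [hΦ.measure_preimage hTm.nullMeasurableSet, hT, Measure.volume_eq_prod, Measure.prod_prod,
      measure_sdiff (Metric.ball_subset_ball hrρ) measurableSet_ball.nullMeasurableSet
        measure_ball_lt_top.ne, EuclideanSpace.volume_ball_fin_two,
      EuclideanSpace.volume_ball_fin_two, Real.volume_Icc]
    rw [ENNReal.ofReal_mul (by linarith)]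
    congr 1
    · congr 1
      ring
    · rw [← ENNReal.ofReal_pow hρ0, ← ENNReal.ofReal_pow hr0, ← ENNReal.ofReal_mul (by positivity),
        ← ENNReal.ofReal_mul (by positivity), ← ENNReal.ofReal_sub _ (by positivity)]
      congr 1
      ring
  have hsub : (⋃ p ∈ S, Metric.ball (toEuclid p) (1 / 2)) ⊆ Φ ⁻¹' T := by
    intro x hx
    simp only [mem_iUnion, exists_prop, Metric.mem_ball, dist_eq_norm] at hx
    obtain ⟨p, hp, hxp⟩ := hx
    obtain ⟨⟨h1, h2⟩, h3, h4⟩ := hS p hp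
    have hn := hΦ2 (toEuclid p)
    rw [norm_toEuclid_sq, hΦ1] at hn
    have hd := hΦ2 (x - toEuclid p)
    have hd1 : |(Φ (x - toEuclid p)).1| ≤ 1 / 2 := by
      refine abs_le_of_sq_le_sq ?_ (by norm_num)
      nlinarith [sq_nonneg ‖(Φ (x - toEuclid p)).2‖, norm_nonneg (x - toEuclid p)]
    have hd2 : ‖(Φ (x - toEuclid p)).2‖ < 1 / 2 := by
      refine lt_of_pow_lt_pow_left₀ 2 (by norm_num) ?_
      nlinarith [sq_nonneg (Φ (x - toEuclid p)).1, norm_nonneg (x - toEuclid p)]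
    rw [map_sub, Prod.fst_sub, hΦ1 (toEuclid p), abs_le] at hd1
    rw [map_sub, Prod.snd_sub] at hd2
    have hp2 : ‖(Φ (toEuclid p)).2‖ ≤ Real.sqrt B := Real.le_sqrt_of_sq_le (by linarith)
    have hp1 : Real.sqrt A ≤ ‖(Φ (toEuclid p)).2‖ :=
      Real.sqrt_le_iff.2 ⟨norm_nonneg _, by linarith⟩
    have t1 := norm_sub_norm_le (Φ x).2 (Φ (toEuclid p)).2
    have t2 := norm_sub_norm_le (Φ (toEuclid p)).2 (Φ x).2
    rw [norm_sub_rev] at t2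
    refine ⟨⟨by linarith, by linarith⟩, ?_, ?_⟩
    · rw [mem_ball_zero_iff]
      linarith
    · rw [mem_ball_zero_iff, not_lt]
      exact max_le (by linarith) (norm_nonneg _)
  have hvol := measure_mono (μ := volume) hsub
  rw [hTvol, measure_biUnion_finset (pairwiseDisjoint_ball _) fun _ _ => measurableSet_ball] at hvol
  simp only [EuclideanSpace.volume_ball_fin_three, Finset.sum_const, nsmul_eq_mul] at hvol
  have hpi := Real.pi_pos
  have hl : 0 ≤ β - α + 1 := by linarith
  rw [← ENNReal.ofReal_pow (by norm_num), ← ENNReal.ofReal_mul (by positivity),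
    ← ENNReal.ofReal_natCast, ← ENNReal.ofReal_mul (by positivity),
    ENNReal.ofReal_le_ofReal_iff (mul_nonneg hl (mul_nonneg hpi.le (by nlinarith)))] at hvol
  -- The factor 6 arises because a ball of radius `1/2` has volume `π/6`.
  have hcard : (S.card : ℝ) ≤ 6 * (β - α + 1) * (ρ ^ 2 - r ^ 2) := by
    refine le_of_mul_le_mul_right ?_ hpi
    linarith
  refine hcard.trans (mul_le_mul_of_nonneg_left ?_ (by positivity))
  have hsA := Real.sq_sqrt hA
  have hsB := Real.sq_sqrt (hA.trans hAB)
  have hsA0 := Real.sqrt_nonneg A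
  have hBR : Real.sqrt B ≤ R := Real.sqrt_le_iff.2 ⟨by linarith, hB⟩
  -- If the inner radius survives the shrinking, `ρ² - r² = B - A + √A + √B`. Otherwise `r = 0`, and
  -- `1 ≤ R` absorbs the constants.
  rcases le_total (Real.sqrt A) (1 / 2) with h | h
  · rw [hr, max_eq_right (by linarith), hρ]
    nlinarith
  · rw [hr, max_eq_left (by linarith), hρ]
    nlinarith

end Counting

/-! ### Geometry of the lune and the number of its points in slabs orthogonal to `k`. -/

section Lindhard

/-- The Euclidean length of a lattice point. -/
noncomputable def len (k : Mom) : ℝ := Real.sqrt (normSq k)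

theorem len_sq (k : Mom) : len k ^ 2 = normSq k := Real.sq_sqrt (normSq_nonneg k)

theorem one_le_len {k : Mom} (hk : k ≠ 0) : 1 ≤ len k :=
  Real.one_le_sqrt.2 (one_le_normSq hk)

theorem norm_toEuclid (k : Mom) : ‖toEuclid k‖ = len k := by
  rw [len, ← norm_toEuclid_sq, Real.sqrt_sq (norm_nonneg _)]

/-- The component of `p` in the direction of `k`. -/
noncomputable def axial (k p : Mom) : ℝ := inner ℝ ((len k)⁻¹ • toEuclid k) (toEuclid p)

theorem norm_axis {k : Mom} (hk : k ≠ 0) : ‖(len k)⁻¹ • toEuclid k‖ = 1 := by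
  have := one_le_len hk
  rw [norm_smul, norm_toEuclid, norm_inv, Real.norm_of_nonneg (by linarith)]
  exact inv_mul_cancel₀ (by linarith)

theorem len_mul_axial {k : Mom} (hk : k ≠ 0) (p : Mom) :
    len k * axial k p = ∑ i, (p i : ℝ) * k i := by
  have := one_le_len hk
  rw [axial, real_inner_smul_left, ← mul_assoc, mul_inv_cancel₀ (by linarith), one_mul]
  simp [toEuclid, PiLp.inner_apply]

theorem lam_eq {k : Mom} (hk : k ≠ 0) (p : Mom) :
    lam k p = len k * axial k p - len k ^ 2 / 2 := by
  rw [len_mul_axial hk, len_sq, lam]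
  simp only [normSq, Finset.mul_sum, ← Finset.sum_sub_distrib, Finset.sum_div, Pi.sub_apply,
    Int.cast_sub]
  exact Finset.sum_congr rfl fun i _ => by ring

theorem axial_add_nsmul {k : Mom} (hk : k ≠ 0) (p : Mom) (m : ℕ) :
    axial k (p + m • k) = axial k p + m * len k := by
  have h := one_le_len hk
  refine mul_left_cancel₀ (by linarith : len k ≠ 0) ?_
  rw [len_mul_axial hk, mul_add, len_mul_axial hk, mul_left_comm, ← pow_two, len_sq, normSq,
    Finset.mul_sum, ← Finset.sum_add_distrib]
  refine Finset.sum_congr rfl fun i _ => ?_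
  have : ((p + m • k) i : ℝ) = p i + m * k i := by simp
  rw [this]
  ring

theorem normSq_add_nsmul {k : Mom} (hk : k ≠ 0) (p : Mom) (m : ℕ) :
    normSq (p + m • k) = normSq p + 2 * m * (len k * axial k p) + m ^ 2 * len k ^ 2 := by
  rw [len_mul_axial hk, len_sq]
  simp only [normSq, Finset.mul_sum, ← Finset.sum_add_distrib]
  refine Finset.sum_congr rfl fun i _ => ?_
  have : ((p + m • k) i : ℝ) = p i + m * k i := by simp
  rw [this]
  ring

theorem axial_sq_le {k : Mom} (hk : k ≠ 0) (p : Mom) : axial k p ^ 2 ≤ normSq p := by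
  have := abs_real_inner_le_norm ((len k)⁻¹ • toEuclid k) (toEuclid p)
  rw [norm_axis hk, one_mul] at this
  rw [← norm_toEuclid_sq]
  exact sq_le_sq.2 (this.trans (le_abs_self _))

variable {kF : ℝ} {k : Mom}

theorem lune_bounds (hkF : 0 ≤ kF) {p : Mom} (hp : p ∈ lune kF k) :
    kF ^ 2 < normSq p ∧ normSq p - 2 * lam k p ≤ kF ^ 2 ∧ 1 / 2 ≤ lam k p := by
  refine ⟨?_, ?_, half_le_lam hkF ⟨p, hp⟩⟩
  · exact not_le.1 (mt (mem_fermiBall hkF _).2 hp.2)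
  · have := (mem_fermiBall hkF _).1 hp.1
    rw [lam]
    linarith

/-- Lattice points of the lune close to the bisecting plane. -/
theorem card_lune_le_of_thin (hkF : 1 ≤ kF) (hk : k ≠ 0) {S : Finset Mom} {T : ℝ}
    (hS : ∀ p ∈ S, p ∈ lune kF k ∧ lam k p ≤ len k * T) (hT : T ≤ len k / 2) (hT0 : 0 ≤ T) :
    (S.card : ℝ) ≤ 12 * (T + 1) * (len k * T + kF) := by
  have hK := one_le_len hk
  set K := len k
  rcases S.eq_empty_or_nonempty with rfl | ⟨p₀, hp₀⟩
  · simp only [Finset.card_empty, Nat.cast_zero]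
    positivity
  set A := max (kF ^ 2 - (K / 2 + T) ^ 2) 0
  -- At axial coordinate `t`, the squared distance from the axis exceeds `k_F² - t²` and is at most
  -- `k_F² - (|k| - t)²`. For `T ≤ |k|/2` this confines the slab to a shell whose squared radii
  -- differ by at most `2|k|T`.
  have key : ∀ p ∈ S, axial k p ∈ Icc (K / 2) (K / 2 + T) ∧
      A ≤ normSq p - axial k p ^ 2 ∧ normSq p - axial k p ^ 2 ≤ kF ^ 2 - (K / 2 - T) ^ 2 := by
    intro p hp
    obtain ⟨hpL, hpT⟩ := hS p hp
    obtain ⟨h1, h2, h3⟩ := lune_bounds (by linarith) hpL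
    have hl : lam k p = K * axial k p - K ^ 2 / 2 := lam_eq hk p
    have hcs := axial_sq_le hk p
    have ht1 : K / 2 ≤ axial k p := by
      refine le_of_mul_le_mul_left ?_ (by linarith : 0 < K)
      nlinarith
    have ht2 : axial k p ≤ K / 2 + T := by
      refine le_of_mul_le_mul_left ?_ (by linarith : 0 < K)
      nlinarith
    refine ⟨⟨ht1, ht2⟩, max_le ?_ (by linarith), ?_⟩
    · nlinarith
    · change lam k p = K * axial k p - K ^ 2 / 2 at hl
      nlinarith
  have hAB : A ≤ kF ^ 2 - (K / 2 - T) ^ 2 := (key p₀ hp₀).2.1.trans (key p₀ hp₀).2.2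
  refine (card_le_of_cylinder (norm_axis hk) (by linarith) (le_max_right _ _) hAB hkF
    (by nlinarith [sq_nonneg (K / 2 - T)]) key).trans ?_
  have hA : kF ^ 2 - (K / 2 + T) ^ 2 ≤ A := le_max_left _ _
  have : kF ^ 2 - (K / 2 - T) ^ 2 - A + 2 * kF ≤ 2 * (K * T + kF) := by nlinarith
  calc 6 * (K / 2 + T - K / 2 + 1) * (kF ^ 2 - (K / 2 - T) ^ 2 - A + 2 * kF)
      ≤ 6 * (K / 2 + T - K / 2 + 1) * (2 * (K * T + kF)) :=
        mul_le_mul_of_nonneg_left this (by linarith)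
    _ = 12 * (T + 1) * (K * T + kF) := by ring

/-- If `p + m k = q + n k` with `m < n`, then `p - k = q + d k` with `d ≥ 0`. As `⟨k, q⟩ > 0`, this
gives `|p - k| ≥ |q| > k_F`, contradicting `p ∈ L_k`. -/
theorem injOn_add_nsmul (hkF : 0 ≤ kF) (hk : k ≠ 0) {S : Set Mom} (hS : S ⊆ lune kF k) :
    Set.InjOn (fun x : Mom × ℕ => x.1 + x.2 • k) {x | x.1 ∈ S} := by
  have key : ∀ p ∈ S, ∀ q ∈ S, ∀ m n : ℕ, p + m • k = q + n • k → ¬ m < n := by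
    intro p hp q hq m n h hmn
    obtain ⟨d, rfl⟩ := Nat.exists_eq_add_of_lt hmn
    have hpq : p - k = q + d • k := by
      have h' : p + m • k = q + d • k + k + m • k := by rw [h]; module
      rw [add_right_cancel h', add_sub_cancel_right]
    obtain ⟨h1, -, h3⟩ := lune_bounds hkF (hS hq)
    have h4 := (mem_fermiBall hkF _).1 (hS hp).1
    rw [hpq, normSq_add_nsmul hk] at h4
    have h5 := lam_eq hk q
    have h6 : 0 ≤ len k * axial k q := by nlinarith [sq_nonneg (len k)]
    have : 0 ≤ 2 * (d : ℝ) * (len k * axial k q) + d ^ 2 * len k ^ 2 := by positivity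
    linarith
  rintro ⟨p, m⟩ hp ⟨q, n⟩ hq h
  simp only at h
  have hmn : m = n := le_antisymm (not_lt.1 (key q hq p hp n m h.symm)) (not_lt.1 (key p hp q hq m n h))
  subst hmn
  rw [add_right_cancel h]

/-- Lattice points of the lune up to a distance `T ≥ |k| / 2` from the bisecting plane: the lines
in the direction of `k` through these points are distinct. -/
theorem card_lune_le_of_thick (hkF : 1 ≤ kF) (hk : k ≠ 0) {S : Finset Mom} {T : ℝ}
    (hS : ∀ p ∈ S, p ∈ lune kF k ∧ lam k p ≤ len k * T) (hT : len k / 2 ≤ T) :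
    (S.card : ℝ) ≤ 24 * len k * (2 * T ^ 2 + kF) := by
  classical
  have hK := one_le_len hk
  set K := len k with hKdef
  set A := max (kF ^ 2 - (K / 2 + T) ^ 2) 0
  -- Direct counting would lose a factor, since the lune is only about `|k|` thick along `k` while
  -- the slab has width `T`. Stacking `M` disjoint translates of `S` along `k` and dividing by `M`
  -- replaces the width `T` by `|k|`.
  set M := ⌈T + 1⌉₊ with hM
  have hMT : T + 1 ≤ M := Nat.le_ceil _
  have hinj := injOn_add_nsmul (k := k) (by linarith : 0 ≤ kF) hk (S := (S : Set Mom))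
    (fun p hp => (hS p hp).1)
  set S' := (S ×ˢ Finset.range M).image fun x : Mom × ℕ => x.1 + x.2 • k with hS'
  have hcard : S'.card = S.card * M := by
    rw [hS', Finset.card_image_of_injOn, Finset.card_product, Finset.card_range]
    exact hinj.mono fun x hx => (Finset.mem_product.1 (Finset.mem_coe.1 hx)).1
  have key : ∀ p ∈ S', axial k p ∈ Icc (K / 2) (K / 2 + T + M * K) ∧
      A ≤ normSq p - axial k p ^ 2 ∧ normSq p - axial k p ^ 2 ≤ kF ^ 2 := by
    intro q hq
    obtain ⟨⟨p, m⟩, hx, rfl⟩ := Finset.mem_image.1 hq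
    obtain ⟨hp, hm⟩ := Finset.mem_product.1 hx
    simp only at hp hm ⊢
    have hmM : (m : ℝ) ≤ M := by exact_mod_cast (Finset.mem_range.1 hm).le
    obtain ⟨hpL, hpT⟩ := hS p hp
    obtain ⟨h1, h2, h3⟩ := lune_bounds (by linarith) hpL
    have hl : lam k p = K * axial k p - K ^ 2 / 2 := lam_eq hk p
    have hcs := axial_sq_le hk p
    have ht1 : K / 2 ≤ axial k p := by
      refine le_of_mul_le_mul_left ?_ (by linarith : 0 < K)
      nlinarith
    have ht2 : axial k p ≤ K / 2 + T := by
      refine le_of_mul_le_mul_left ?_ (by linarith : 0 < K)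
      nlinarith
    have hw : normSq (p + m • k) - axial k (p + m • k) ^ 2 = normSq p - axial k p ^ 2 := by
      rw [normSq_add_nsmul hk, axial_add_nsmul hk]
      ring
    rw [hw, axial_add_nsmul hk, ← hKdef]
    refine ⟨⟨?_, ?_⟩, max_le ?_ (by linarith), ?_⟩
    · have : 0 ≤ (m : ℝ) * K := by positivity
      linarith
    · have : (m : ℝ) * K ≤ M * K := mul_le_mul_of_nonneg_right hmM (by linarith)
      linarith
    · nlinarith
    · nlinarith [sq_nonneg (axial k p - K)]
  have hA : kF ^ 2 - (K / 2 + T) ^ 2 ≤ A := le_max_left _ _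
  have hAB : A ≤ kF ^ 2 := max_le (by nlinarith [sq_nonneg (K / 2 + T)]) (sq_nonneg _)
  have hMK : (M : ℝ) ≤ M * K := le_mul_of_one_le_right (Nat.cast_nonneg _) hK
  have h := card_le_of_cylinder (norm_axis hk) (by linarith) (le_max_right _ _) hAB hkF le_rfl key
  rw [hcard, Nat.cast_mul] at h
  have hM0 : (0 : ℝ) < M := by linarith
  refine le_of_mul_le_mul_right (h.trans ?_) hM0
  -- Here `T + 1 ≤ M ≤ M |k|`: the stack is long enough to absorb both the slab width and the unit
  -- error.
  have e1 : K / 2 + T + M * K - K / 2 + 1 ≤ 2 * (M * K) := by linarith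
  have e2 : kF ^ 2 - A + 2 * kF ≤ 2 * (2 * T ^ 2 + kF) := by nlinarith
  calc 6 * (K / 2 + T + M * K - K / 2 + 1) * (kF ^ 2 - A + 2 * kF)
      ≤ 6 * (2 * (M * K)) * (2 * (2 * T ^ 2 + kF)) := by
        refine mul_le_mul (by linarith) e2 (by linarith) (by positivity)
    _ = 24 * K * (2 * T ^ 2 + kF) * M := by ring

end Lindhard

/-! ### The bound `∑ λ⁻¹ ≤ C k_F` by dyadic decomposition. -/

section Lindhard

variable {kF : ℝ} {k : Mom}

theorem len_mul_half_sub_le_lam (hkF : 0 ≤ kF) (hk : k ≠ 0) {p : Mom} (hp : p ∈ lune kF k) :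
    len k * (len k / 2 - kF) ≤ lam k p ∧ lam k p ≤ len k * (kF + len k / 2) := by
  have hK := one_le_len hk
  obtain ⟨h1, h2, h3⟩ := lune_bounds hkF hp
  have hl := lam_eq hk p
  have hcs := axial_sq_le hk p
  have h4 : (axial k p - len k) ^ 2 ≤ kF ^ 2 := by nlinarith
  have h5 := abs_le.1 (abs_le_of_sq_le_sq h4 hkF)
  constructor <;> nlinarith

open Classical in
/-- Momenta in the lune at distance at most `T` from the bisecting plane. -/
noncomputable def luneSlab (kF : ℝ) (k : Mom) (T : ℝ) : Finset Mom :=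
  (lune kF k).toFinset.filter fun p => lam k p ≤ len k * T

theorem mem_luneSlab {T : ℝ} {p : Mom} :
    p ∈ luneSlab kF k T ↔ p ∈ lune kF k ∧ lam k p ≤ len k * T := by
  classical
  simp [luneSlab]

theorem sum_luneSlab_one_le (hkF : 1 ≤ kF) (hk : k ≠ 0) (hkk : len k ≤ 3 * kF) :
    ∑ p ∈ luneSlab kF k 1, (lam k p)⁻¹ ≤ 288 * kF := by
  have hK := one_le_len hk
  have hS : ∀ p ∈ luneSlab kF k 1, p ∈ lune kF k ∧ lam k p ≤ len k * 1 :=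
    fun p hp => mem_luneSlab.1 hp
  have hcard : ((luneSlab kF k 1).card : ℝ) ≤ 144 * kF := by
    rcases le_total 2 (len k) with h | h
    · have := card_lune_le_of_thin hkF hk hS (by linarith) zero_le_one
      linarith
    · have := card_lune_le_of_thick hkF hk hS (by linarith)
      nlinarith
  refine (Finset.sum_le_card_nsmul _ _ 2 fun p hp => ?_).trans ?_
  · have h3 := (lune_bounds (by linarith) (hS p hp).1).2.2
    rw [inv_le_comm₀ (by linarith) (by norm_num)]
    linarith
  · rw [nsmul_eq_mul]
    linarith

/-- On the dyadic layer `λ > |k| T`, so the sum is at most the number of points divided by `|k| T`.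
Both `T` and `k_F / T` are summable over dyadic `T` up to order `k_F`, with total of order `k_F`. -/
theorem sum_luneSlab_sdiff_le (hkF : 1 ≤ kF) (hk : k ≠ 0) {T : ℝ} (hT : 1 ≤ T) :
    ∑ p ∈ luneSlab kF k (2 * T) \ luneSlab kF k T, (lam k p)⁻¹ ≤ 192 * T + 24 * kF * T⁻¹ := by
  have hK := one_le_len hk
  set S := luneSlab kF k (2 * T) \ luneSlab kF k T
  have hS : ∀ p ∈ S, p ∈ lune kF k ∧ lam k p ≤ len k * (2 * T) :=
    fun p hp => mem_luneSlab.1 (Finset.mem_sdiff.1 hp).1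
  have hKT : 0 < len k * T := by positivity
  have hcard : (S.card : ℝ) ≤ (192 * T + 24 * kF * T⁻¹) * (len k * T) := by
    have e : (192 * T + 24 * kF * T⁻¹) * (len k * T) = len k * (192 * T ^ 2 + 24 * kF) := by
      field_simp
    rw [e]
    rcases le_total (2 * T) (len k / 2) with h | h
    · have := card_lune_le_of_thin hkF hk hS h (by linarith)
      refine this.trans ?_
      have h1 : 12 * (2 * T + 1) * (len k * (2 * T) + kF) ≤
          12 * (3 * T) * (len k * (2 * T) + kF) := by
        gcongr
        linarith
      refine h1.trans ?_
      nlinarith [mul_le_mul_of_nonneg_right h (by linarith : 0 ≤ kF),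
        mul_nonneg (by linarith : 0 ≤ len k) (sq_nonneg T)]
    · have := card_lune_le_of_thick hkF hk hS h
      linarith
  refine (Finset.sum_le_card_nsmul _ _ (len k * T)⁻¹ fun p hp => ?_).trans ?_
  · refine inv_anti₀ hKT (le_of_not_ge fun h => ?_)
    exact (Finset.mem_sdiff.1 hp).2 (mem_luneSlab.2 ⟨(hS p hp).1, h⟩)
  · rw [nsmul_eq_mul, ← div_eq_mul_inv, div_le_iff₀ hKT]
    exact hcard

theorem sum_luneSlab_two_pow_le (hkF : 1 ≤ kF) (hk : k ≠ 0) (hkk : len k ≤ 3 * kF) (J : ℕ) :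
    ∑ p ∈ luneSlab kF k (2 ^ J), (lam k p)⁻¹ ≤
      288 * kF + 192 * (2 ^ J - 1) + 48 * kF * (1 - (2 ^ J)⁻¹) := by
  induction J with
  | zero => simpa using sum_luneSlab_one_le hkF hk hkk
  | succ J ih =>
    have hK := one_le_len hk
    have hT : (1 : ℝ) ≤ 2 ^ J := one_le_pow₀ (by norm_num)
    have hsub : luneSlab kF k (2 ^ J) ⊆ luneSlab kF k (2 * 2 ^ J) := fun p hp => by
      obtain ⟨h1, h2⟩ := mem_luneSlab.1 hp
      refine mem_luneSlab.2 ⟨h1, h2.trans (mul_le_mul_of_nonneg_left ?_ ?_)⟩ <;> linarith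
    have h := sum_luneSlab_sdiff_le hkF hk hT
    rw [pow_succ', ← Finset.sum_sdiff hsub, mul_inv]
    linarith

/-- The Riemann sum bound for the Lindhard function at zero frequency. -/
theorem sum_inv_lam_le (hkF : 1 ≤ kF) (hk : k ≠ 0) :
    ∑ p : lune kF k, (lam k p)⁻¹ ≤ 1488 * kF := by
  have hK := one_le_len hk
  rw [Finset.sum_set_coe (lune kF k) (f := fun p => (lam k p)⁻¹)]
  -- For `|k| ≥ 3 k_F` no layers are needed: `λ ≥ |k|²/6` throughout the lune, which has at most `54
  -- k_F³` points.
  rcases le_total (len k) (3 * kF) with hkk | hkk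
  · obtain ⟨n, hn1, hn2⟩ := exists_nat_pow_near (by linarith : 1 ≤ 3 * kF) (one_lt_two)
    have h := sum_luneSlab_two_pow_le hkF hk hkk (n + 1)
    have hsub : (lune kF k).toFinset ⊆ luneSlab kF k (2 ^ (n + 1)) := fun p hp => by
      rw [Set.mem_toFinset] at hp
      refine mem_luneSlab.2 ⟨hp, (len_mul_half_sub_le_lam (by linarith) hk hp).2.trans ?_⟩
      refine mul_le_mul_of_nonneg_left ?_ (by linarith)
      linarith
    refine (Finset.sum_le_sum_of_subset_of_nonneg hsub fun p hp _ => ?_).trans (h.trans ?_)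
    · have := (lune_bounds (by linarith) (mem_luneSlab.1 hp).1).2.2
      exact inv_nonneg.2 (by linarith)
    -- Since `2^(n+1) ≤ 6 k_F`, the total is at most `(288 + 192 · 6 + 48) k_F = 1488 k_F`.
    · have h1 : 0 ≤ kF * (2 ^ (n + 1))⁻¹ := by positivity
      rw [pow_succ] at h1 ⊢
      linarith
  · have hlam : ∀ p ∈ (lune kF k).toFinset, len k ^ 2 / 6 ≤ lam k p := fun p hp => by
      have := (len_mul_half_sub_le_lam (by linarith) hk (Set.mem_toFinset.1 hp)).1
      nlinarith
    have hcard : ((lune kF k).toFinset.card : ℝ) ≤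
        6 * (len k + kF - (len k - kF) + 1) * (kF ^ 2 - 0 + 2 * kF) := by
      refine card_le_of_cylinder (norm_axis hk) (by linarith) le_rfl (sq_nonneg _) hkF le_rfl
        fun p hp => ?_
      change axial k p ∈ _ ∧ 0 ≤ normSq p - axial k p ^ 2 ∧ normSq p - axial k p ^ 2 ≤ _
      obtain ⟨h1, h2, h3⟩ := lune_bounds (by linarith : 0 ≤ kF) (Set.mem_toFinset.1 hp)
      have hl := lam_eq hk p
      have hcs := axial_sq_le hk p
      have h4 : (axial k p - len k) ^ 2 ≤ kF ^ 2 := by nlinarith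
      have h5 := abs_le.1 (abs_le_of_sq_le_sq h4 (by linarith))
      refine ⟨⟨by linarith, by linarith⟩, by linarith, ?_⟩
      nlinarith [sq_nonneg (axial k p - len k)]
    have hc2 : ((lune kF k).toFinset.card : ℝ) ≤ 54 * kF * kF ^ 2 := by
      refine hcard.trans ?_
      have : 6 * (len k + kF - (len k - kF) + 1) * (kF ^ 2 - 0 + 2 * kF) ≤
          6 * (3 * kF) * (3 * kF ^ 2) := by
        refine mul_le_mul ?_ ?_ ?_ ?_ <;> nlinarith
      linarith
    have hk2 : 9 * kF ^ 2 ≤ len k ^ 2 := by nlinarith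
    refine (Finset.sum_le_card_nsmul _ _ (len k ^ 2 / 6)⁻¹ fun p hp => ?_).trans ?_
    · exact inv_anti₀ (by positivity) (hlam p hp)
    · rw [nsmul_eq_mul, ← div_eq_mul_inv, div_le_iff₀ (by positivity)]
      nlinarith

end Lindhard

/-! ### The gap at the Fermi surface and the weight `m(ξ)`. -/

section Gap

variable {kF : ℝ} {k : Mom}

theorem zero_mem_fermiBall (hkF : 0 ≤ kF) : (0 : Mom) ∈ fermiBall kF := by
  rw [mem_fermiBall hkF]
  simpa [normSq] using sq_nonneg kF

theorem le_sSup_fermiBall {q : Mom} (hq : q ∈ fermiBall kF) :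
    normSq q ≤ sSup (normSq '' fermiBall kF) :=
  le_csSup ((fermiBall_finite kF).image _).bddAbove (mem_image_of_mem _ hq)

theorem sInf_compl_fermiBall_le {p : Mom} (hp : p ∉ fermiBall kF) :
    sInf (normSq '' (fermiBall kF)ᶜ) ≤ normSq p := by
  refine csInf_le ⟨0, ?_⟩ (mem_image_of_mem _ hp)
  rintro - ⟨q, -, rfl⟩
  exact normSq_nonneg q

/-- By integrality, `⌊k_F²⌋ + 1` lies strictly above every energy inside the ball and not above any
energy outside. -/
theorem sSup_lt_sInf (hkF : 0 ≤ kF) :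
    sSup (normSq '' fermiBall kF) < sInf (normSq '' (fermiBall kF)ᶜ) := by
  have h1 : sSup (normSq '' fermiBall kF) ≤ kF ^ 2 := by
    refine csSup_le ⟨_, mem_image_of_mem _ (zero_mem_fermiBall hkF)⟩ ?_
    rintro - ⟨q, hq, rfl⟩
    exact (mem_fermiBall hkF _).1 hq
  have h2 : ((⌊kF ^ 2⌋ : ℤ) : ℝ) + 1 ≤ sInf (normSq '' (fermiBall kF)ᶜ) := by
    refine le_csInf ((fermiBall_finite kF).infinite_compl.nonempty.image _) ?_
    rintro - ⟨q, hq, rfl⟩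
    have h3 := not_le.1 (mt (mem_fermiBall hkF q).2 hq)
    rw [normSq_eq_intCast] at h3 ⊢
    have h4 : ⌊kF ^ 2⌋ + 1 ≤ ∑ i, q i ^ 2 := Int.add_one_le_iff.2 (Int.floor_lt.2 h3)
    exact_mod_cast h4
  linarith [Int.lt_floor_add_one (kF ^ 2)]

theorem normSq_neg (p : Mom) : normSq (-p) = normSq p := by simp [normSq]

/-- The weight `m(ξ)` controls the inverse excitation energies. -/
theorem inv_lam_le_gapWeight (hkF : 0 ≤ kF) {ξ ζ : Mom} (hζ : ζ ∈ dLune kF k ξ) :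
    (lam k ζ)⁻¹ ≤ 2 * gapWeight kF ξ := by
  classical
  have hL := mem_lune_of_mem_dLune hζ
  have hab := sSup_lt_sInf hkF
  have h1 := le_sSup_fermiBall hL.1
  have h2 := sInf_compl_fermiBall_le hL.2
  have hlam : lam k ζ = (1 / 2) * (normSq ζ - normSq (ζ - k)) := rfl
  have hκ : kappa kF = (1 / 2) *
    (sInf (normSq '' (fermiBall kF)ᶜ) + sSup (normSq '' fermiBall kF)) := rfl
  have hcase : normSq ζ = normSq ξ ∨ normSq (ζ - k) = normSq ξ := by
    simp only [dLune, dSet, Finset.mem_filter, Finset.mem_insert, Finset.mem_singleton] at hζ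
    rcases hζ.1 with rfl | rfl | rfl | rfl
    · exact Or.inl rfl
    · exact Or.inl (normSq_neg _)
    · right
      rw [add_sub_cancel_left]
    · right
      rw [sub_sub_cancel_left, normSq_neg]
  -- `κ` lies strictly between `|ζ - k|²` and `|ζ|²`, whose difference is `2λ`, and `|ξ|²` is one of
  -- the two. Strict positivity matters: otherwise `m(ξ)` would take the default value `0⁻¹ = 0`.
  have hkey : 0 < |normSq ξ - kappa kF| ∧ |normSq ξ - kappa kF| ≤ 2 * lam k ζ := by
    rcases hcase with h | h
    · rw [abs_of_pos (by linarith)]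
      constructor <;> linarith
    · rw [abs_of_neg (by linarith)]
      constructor <;> linarith
  rw [gapWeight, ← div_eq_mul_inv, le_div_iff₀ hkey.1, inv_mul_le_iff₀ (by linarith)]
  linarith

theorem gapWeight_nonneg (kF : ℝ) (ξ : Mom) : 0 ≤ gapWeight kF ξ := inv_nonneg.2 (abs_nonneg _)

theorem card_dLune_le (ξ : Mom) : (dLune kF k ξ).card ≤ 4 := by
  classical
  exact (Finset.card_filter_le _ _).trans Finset.card_le_four

end Gap

/-! ### Radii `k_F < 1`: the Fermi ball is the origin alone. -/

section SmallBall

variable {kF : ℝ} {k : Mom}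

theorem mem_fermiBall_iff_of_lt_one (hkF : 0 < kF) (h1 : kF < 1) (p : Mom) :
    p ∈ fermiBall kF ↔ p = 0 := by
  refine ⟨fun h => ?_, fun h => h ▸ zero_mem_fermiBall hkF.le⟩
  by_contra hp
  have h2 := one_le_normSq hp
  have h3 := (mem_fermiBall hkF.le p).1 h
  nlinarith

theorem mem_lune_iff_of_lt_one (hkF : 0 < kF) (h1 : kF < 1) (hk : k ≠ 0) (p : Mom) :
    p ∈ lune kF k ↔ p = k := by
  rw [lune, mem_ofPred_eq, mem_fermiBall_iff_of_lt_one hkF h1, mem_fermiBall_iff_of_lt_one hkF h1,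
    sub_eq_zero]
  exact ⟨fun h => h.1, fun h => ⟨h, h ▸ hk⟩⟩

/-- Testing `inv_lam_le_gapWeight` with a unit vector `k = ζ`, for which `λ = 1/2`, avoids computing
`κ`. -/
theorem one_le_gapWeight_zero (hkF : 0 < kF) (h1 : kF < 1) : 1 ≤ gapWeight kF 0 := by
  classical
  have he : (Pi.single 0 1 : Mom) ≠ 0 := by simp
  have hmem : (Pi.single 0 1 : Mom) ∈ dLune kF (Pi.single 0 1) 0 := by
    simp [dLune, dSet, mem_lune_iff_of_lt_one hkF h1 he]
  have h := inv_lam_le_gapWeight hkF.le hmem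
  have hl : lam (Pi.single 0 1) (Pi.single 0 1) = 1 / 2 := by
    simp [lam, normSq, Fin.sum_univ_three]
  rw [hl] at h
  linarith

end SmallBall

/-! ### Summability of the majorant over `k`. -/

section Sums

/-- The exponent 4 of `|k|⁻¹` exceeds the rank 3 of the lattice; the term at `k = 0` is `0` by the
convention for inverses. -/
theorem summable_inv_normSq_sq : Summable fun k : Mom => (normSq k ^ 2)⁻¹ := by
  set b := (EuclideanSpace.basisFun (Fin 3) ℝ).toBasis
  set L := Submodule.span ℤ (Set.range b)
  have hmem : ∀ p : Mom, toEuclid p ∈ L := fun p => by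
    rw [b.mem_span_iff_repr_mem ℤ]
    intro i
    exact ⟨p i, by simp [b, toEuclid]⟩
  have hinj : Function.Injective fun p : Mom => (⟨toEuclid p, hmem p⟩ : L) := fun p q h => by
    have h' : toEuclid p = toEuclid q := congrArg Subtype.val h
    ext i
    have := congrFun (congrArg WithLp.ofLp h') i
    simpa [toEuclid] using this
  have hrank : Module.finrank ℤ L = 3 := by
    rw [ZLattice.rank ℝ L]
    simp
  have h := (ZLattice.summable_norm_pow_inv L 4 (by rw [hrank]; norm_num)).comp_injective hinj
  refine h.congr fun p => ?_
  change ‖toEuclid p‖⁻¹ ^ 4 = _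
  rw [← norm_toEuclid_sq, ← pow_mul, inv_pow]

/-- The majorant of the contribution of `k` to the momentum distribution at `ξ`. -/
noncomputable def majorant (V : Mom → ℝ) (ξ k : Mom) : ℝ :=
  V k ^ 2 + (normSq k ^ 2)⁻¹ + ((if k = ξ then 1 else 0) + (if k = -ξ then 1 else 0))

theorem majorant_nonneg (V : Mom → ℝ) (ξ k : Mom) : 0 ≤ majorant V ξ k := by
  unfold majorant
  positivity

theorem hasSum_majorant {V : Mom → ℝ} (hV : Summable fun k => V k ^ 2) (ξ : Mom) :
    HasSum (majorant V ξ) (ell2Norm V ^ 2 + ∑' k, (normSq k ^ 2)⁻¹ + (1 + 1)) := by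
  rw [ell2Norm, Real.sq_sqrt (tsum_nonneg fun k => sq_nonneg _)]
  exact (hV.hasSum.add summable_inv_normSq_sq.hasSum).add
    ((hasSum_ite_eq ξ 1).add (hasSum_ite_eq (-ξ) 1))

end Sums

/-! ### The bound for a single `k`, uniform in `k_F`. -/

section Bound

variable {kF : ℝ} {V : Mom → ℝ} {k : Mom}

theorem coupling_le (hkF : 0 < kF) (hV : 0 ≤ V k) : coupling kF V k ≤ kF⁻¹ * V k := by
  refine div_le_self (by positivity) ?_
  have h1 : 1 ≤ 2 * Real.pi := by linarith [Real.pi_gt_three]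
  nlinarith [one_le_pow₀ h1 (n := 3)]

theorem sum_coshElt_le (hkF : 0 < kF) (hV : 0 ≤ V k) (hk : k ≠ 0) {t : ℝ}
    (ht : t ∈ Icc (0 : ℝ) 1) (ξ : Mom) :
    ∑ ζ ∈ dLune kF k ξ, coshElt kF V t k ζ ≤
      23808 * kF⁻¹ * gapWeight kF ξ * majorant V ξ k := by
  classical
  have hE := (posDef_eOp hkF hV).isHermitian
  have hm := gapWeight_nonneg kF ξ
  have hg := coupling_nonneg hkF hV
  have hg' := coupling_le hkF hV
  have hkF' : 0 < kF⁻¹ := inv_pos.2 hkF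
  have hVm : V k ^ 2 ≤ majorant V ξ k := by
    rw [majorant, add_assoc]
    exact le_add_of_nonneg_right (by positivity)
  -- For `1 ≤ k_F` the second-order bound gives `5952 = 2 · 1488 · 2` per point `ζ`, and four points
  -- give 23808.
  rcases le_or_gt 1 kF with h1 | h1
  · have hb : ∀ ζ ∈ dLune kF k ξ, coshElt kF V t k ζ ≤
        5952 * kF⁻¹ * gapWeight kF ξ * majorant V ξ k := fun ζ hζ => by
      have hL := mem_lune_of_mem_dLune hζ
      refine (coshElt_le_one hE ht ⟨ζ, hL⟩).trans ((coshElt_one_le_sq hkF hV ⟨ζ, hL⟩).trans ?_)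
      have hl : 0 < lam k ζ := lam_pos hkF.le ⟨ζ, hL⟩
      have hsq : coupling kF V k ^ 2 ≤ (kF⁻¹ * V k) ^ 2 := pow_le_pow_left₀ hg hg' 2
      calc 2 * coupling kF V k ^ 2 * (∑ p : lune kF k, (lam k p)⁻¹) * (lam k ζ)⁻¹
          ≤ 2 * coupling kF V k ^ 2 * (1488 * kF) * (2 * gapWeight kF ξ) :=
            mul_le_mul (mul_le_mul_of_nonneg_left (sum_inv_lam_le h1 hk) (by positivity))
              (inv_lam_le_gapWeight hkF.le hζ) (inv_pos.2 hl).le (by positivity)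
        _ ≤ 2 * (kF⁻¹ * V k) ^ 2 * (1488 * kF) * (2 * gapWeight kF ξ) := by
            have : 0 ≤ kF * gapWeight kF ξ := mul_nonneg hkF.le hm
            nlinarith
        _ = 5952 * kF⁻¹ * gapWeight kF ξ * V k ^ 2 := by
            field_simp
            ring
        _ ≤ _ := mul_le_mul_of_nonneg_left hVm (by positivity)
    refine (Finset.sum_le_card_nsmul _ _ _ hb).trans ?_
    have hc : ((dLune kF k ξ).card : ℝ) ≤ 4 := by exact_mod_cast card_dLune_le ξ
    have hM : 0 ≤ 5952 * kF⁻¹ * gapWeight kF ξ * majorant V ξ k := by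
      have := majorant_nonneg V ξ k
      positivity
    rw [nsmul_eq_mul]
    nlinarith
  -- For small `k_F` the second-order bound would cost `k_F⁻²`, so the first-order bound is used. It
  -- is linear in `V_k`, hence the extra terms of `majorant`.
  · have hsub : dLune kF k ξ ⊆ {k} := fun ζ hζ =>
      Finset.mem_singleton.2 ((mem_lune_iff_of_lt_one hkF h1 hk ζ).1 (mem_lune_of_mem_dLune hζ))
    have hM0 := majorant_nonneg V ξ k
    rcases Finset.subset_singleton_iff.1 hsub with h0 | h0
    · rw [h0, Finset.sum_empty]
      positivity
    have hkd : k ∈ dLune kF k ξ := h0 ▸ Finset.mem_singleton_self k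
    have hL := mem_lune_of_mem_dLune hkd
    rw [h0, Finset.sum_singleton]
    have hlam : lam k k = normSq k / 2 := by
      simp only [lam, sub_self]
      simp [normSq]
      ring
    have hl : 0 < lam k k := lam_pos hkF.le ⟨k, hL⟩
    have hVl : V k * (lam k k)⁻¹ ≤ 2 * gapWeight kF ξ * majorant V ξ k := by
      have hcase : ξ = 0 ∨ k = ξ ∨ k = -ξ := by
        have := hkd
        simp only [dLune, dSet, Finset.mem_filter, Finset.mem_insert, Finset.mem_singleton] at this
        rcases this.1 with h | h | h | h
        · exact Or.inr (Or.inl h)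
        · exact Or.inr (Or.inr h)
        · exact Or.inl (by simpa using h)
        · exact Or.inl (sub_eq_self.1 h.symm)
      rcases hcase with rfl | hcase
      · have hm1 := one_le_gapWeight_zero hkF h1
        -- As `λ_{k,k}⁻¹ = 2|k|⁻²`, this is the inequality `2ab ≤ a² + b²`.
        have e : V k * (lam k k)⁻¹ ≤ V k ^ 2 + (normSq k ^ 2)⁻¹ := by
          rw [hlam, inv_div, div_eq_mul_inv, ← inv_pow]
          nlinarith [sq_nonneg (V k - (normSq k)⁻¹)]
        have e2 : V k ^ 2 + (normSq k ^ 2)⁻¹ ≤ majorant V 0 k := by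
          rw [majorant]
          exact le_add_of_nonneg_right (by positivity)
        nlinarith
      · have e : 1 ≤ (if k = ξ then (1 : ℝ) else 0) + (if k = -ξ then 1 else 0) := by
          rcases hcase with h | h
          · rw [if_pos h]
            exact le_add_of_nonneg_right (by positivity)
          · rw [if_pos h]
            exact le_add_of_nonneg_left (by positivity)
        -- `V_k ≤ V_k² + 1`, where the `1` is affordable because only the two momenta `k = ±ξ`
        -- occur.
        have e2 : V k ≤ majorant V ξ k := by
          have : 0 ≤ (normSq k ^ 2)⁻¹ := by positivity
          rw [majorant]
          nlinarith [sq_nonneg (V k - 1)]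
        have e3 := inv_lam_le_gapWeight hkF.le hkd
        calc V k * (lam k k)⁻¹ ≤ majorant V ξ k * (2 * gapWeight kF ξ) :=
              mul_le_mul e2 e3 (inv_pos.2 hl).le hM0
          _ = _ := by ring
    calc coshElt kF V t k k ≤ coupling kF V k * (lam k k)⁻¹ :=
          (coshElt_le_one hE ht ⟨k, hL⟩).trans (coshElt_one_le hkF hV ⟨k, hL⟩)
      _ ≤ kF⁻¹ * V k * (lam k k)⁻¹ := mul_le_mul_of_nonneg_right hg' (inv_pos.2 hl).le
      _ = kF⁻¹ * (V k * (lam k k)⁻¹) := by ring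
      _ ≤ kF⁻¹ * (2 * gapWeight kF ξ * majorant V ξ k) := mul_le_mul_of_nonneg_left hVl hkF'.le
      _ ≤ 23808 * kF⁻¹ * gapWeight kF ξ * majorant V ξ k := by
          have : 0 ≤ kF⁻¹ * (gapWeight kF ξ * majorant V ξ k) := by positivity
          linarith

end Bound

end FermiGas

/-! ### Assembly of the proposition. -/

theorem proposition3p3 :
    ∃ C : ℝ → ℝ, (∀ r : ℝ, 0 < C r) ∧
      ∀ (kF : ℝ) (V : FermiGas.Mom → ℝ), 0 < kF →
        (∀ k, 0 ≤ V k) → (∀ k, V (-k) = V k) → V 0 = 0 → (Summable fun k => V k ^ 2) →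
        ∀ ξ : FermiGas.Mom,
          (∀ t ∈ Set.Icc (0 : ℝ) 1,
            (Summable fun k : FermiGas.MomStar => FermiGas.traceIntegral kF V t ξ k) ∧
            (Summable fun k : FermiGas.MomStar =>
              ∑ ζ ∈ FermiGas.dLune kF k ξ, FermiGas.coshElt kF V t k ζ) ∧
            FermiGas.nBoson kF V t ξ =
              (1 / 4) * ∑' k : FermiGas.MomStar,
                ∑ ζ ∈ FermiGas.dLune kF k ξ, FermiGas.coshElt kF V t k ζ ∧
            0 ≤ FermiGas.nBoson kF V t ξ ∧
            FermiGas.nBoson kF V t ξ ≤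
              C (FermiGas.ell2Norm V) * kF⁻¹ * FermiGas.gapWeight kF ξ) ∧
          (∀ k : FermiGas.MomStar, ∀ ζ ∈ FermiGas.dLune kF k ξ,
            MeasureTheory.IntegrableOn (FermiGas.bosonIntegrand kF V k ζ) (Set.Ioi 0)) ∧
          (Summable fun k : FermiGas.MomStar =>
            ∑ ζ ∈ FermiGas.dLune kF k ξ,
              V k * ∫ s in Set.Ioi (0 : ℝ), FermiGas.bosonIntegrand kF V k ζ s) ∧
          FermiGas.nBoson kF V 1 ξ =
            kF⁻¹ / (32 * Real.pi ^ 4) * ∑' k : FermiGas.MomStar,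
              ∑ ζ ∈ FermiGas.dLune kF k ξ,
                V k * ∫ s in Set.Ioi (0 : ℝ), FermiGas.bosonIntegrand kF V k ζ s := by
  open FermiGas in
  have hS0 : 0 ≤ ∑' k : Mom, (normSq k ^ 2)⁻¹ := tsum_nonneg fun k => by positivity
  -- `5952 = 23808 / 4`, with the prefactor `1/4` of the `cosh` formula; the bracket is the sum of
  -- `majorant` over all `k`, where `r = ‖V‖` and the two ones come from `k = ±ξ`.
  refine ⟨fun r => 5952 * (r ^ 2 + ∑' k, (normSq k ^ 2)⁻¹ + (1 + 1)), fun r => by positivity, ?_⟩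
  intro kF V hkF hV _ _ hsum ξ
  have hE : ∀ k, (eOp kF V k).IsHermitian := fun k => (posDef_eOp hkF (hV k)).isHermitian
  have hnonneg : ∀ (t : ℝ) (k : MomStar), 0 ≤ ∑ ζ ∈ dLune kF k ξ, coshElt kF V t k ζ :=
    fun t k => Finset.sum_nonneg fun ζ hζ => coshElt_nonneg (hE k) t ⟨ζ, mem_lune_of_mem_dLune hζ⟩
  have hmaj := (hasSum_majorant hsum ξ)
  have hmaj' : Summable fun k : MomStar => majorant V ξ k := hmaj.summable.subtype _
  have hle : ∀ t ∈ Set.Icc (0 : ℝ) 1, ∀ k : MomStar, ∑ ζ ∈ dLune kF k ξ, coshElt kF V t k ζ ≤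
      23808 * kF⁻¹ * gapWeight kF ξ * majorant V ξ k :=
    fun t ht k => sum_coshElt_le hkF (hV k) k.2 ht ξ
  have hcosh : ∀ t ∈ Set.Icc (0 : ℝ) 1,
      Summable fun k : MomStar => ∑ ζ ∈ dLune kF k ξ, coshElt kF V t k ζ := fun t ht =>
    Summable.of_nonneg_of_le (hnonneg t) (hle t ht) (hmaj'.mul_left _)
  have htrace : ∀ (t : ℝ) (k : MomStar), traceIntegral kF V t ξ k =
      (1 / 2) * ∑ ζ ∈ dLune kF k ξ, coshElt kF V t k ζ := fun t k => traceIntegral_eq (hE k) t ξ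
  have hn : ∀ t, nBoson kF V t ξ =
      (1 / 4) * ∑' k : MomStar, ∑ ζ ∈ dLune kF k ξ, coshElt kF V t k ζ := fun t => by
    simp only [nBoson, htrace, tsum_mul_left]
    ring
  have hint : ∀ k : MomStar, ∑ ζ ∈ dLune kF k ξ, coshElt kF V 1 k ζ = kF⁻¹ / (8 * Real.pi ^ 4) *
      ∑ ζ ∈ dLune kF k ξ, V k * ∫ s in Set.Ioi (0 : ℝ), bosonIntegrand kF V k ζ s := fun k => by
    rw [Finset.mul_sum]
    refine Finset.sum_congr rfl fun ζ hζ => ?_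
    have hpi := Real.pi_pos.ne'
    rw [coshElt_one_eq_integral hkF (hV k) ⟨ζ, mem_lune_of_mem_dLune hζ⟩, coupling, ← mul_assoc]
    congr 1
    field_simp
    ring
  refine ⟨fun t ht => ⟨?_, hcosh t ht, hn t, ?_, ?_⟩, ?_, ?_, ?_⟩
  · simp only [htrace]
    exact (hcosh t ht).mul_left _
  · rw [hn]
    exact mul_nonneg (by norm_num) (tsum_nonneg (hnonneg t))
  · have h1 := (hcosh t ht).tsum_le_tsum (hle t ht) (hmaj'.mul_left _)
    have h2 : ∑' k : MomStar, majorant V ξ k ≤ ∑' k, majorant V ξ k :=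
      Summable.tsum_subtype_le _ {k : Mom | k ≠ 0} (majorant_nonneg V ξ) hmaj.summable
    rw [tsum_mul_left] at h1
    rw [hmaj.tsum_eq] at h2
    have hm := gapWeight_nonneg kF ξ
    have h3 := mul_le_mul_of_nonneg_left h2
      (by positivity : 0 ≤ 23808 * kF⁻¹ * gapWeight kF ξ)
    rw [hn]
    linarith
  · exact fun k ζ hζ => integrableOn_bosonIntegrand hkF (hV k) ⟨ζ, mem_lune_of_mem_dLune hζ⟩
  · have h := hcosh 1 (by simp)
    simp only [hint] at h
    exact (summable_mul_left_iff (by positivity)).1 h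
  · rw [hn]
    simp only [hint, tsum_mul_left]
    ring
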